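/- **Model.** Let $V$ be a vocabulary of $n\ge 2$ words, with embeddings $v_w\in\mathbb R^d$ ($w\in V$, $d\ge 1$), and let $T\in\mathbb R^{d\times d\times d}$ be a composition tensor; write $T(x,y,z)=\sum_{i,j,k}T_{ijk}x_iy_jz_k$, $T(x,y,\cdot)_k=\sum_{i,j}T_{ijk}x_iy_j$ and $T(x,\cdot,\cdot)_{jk}=\sum_i T_{ijk}x_i$. Embeddings and tensor are fixed; all probabilities below are conditional on them. In the syntactic RAND-WALK model the discourse vectors $c_0,c_1,c_2,\dots$ form a stationary Markov chain on the unit sphere of $\mathbb R^d$ whose stationary distribution is the uniform distribution $\mathcal C$, and $\|c_t-c_{t+1}\|\le \epsilon_w/\sqrt d$ almost surely. Put $$Z_c=\sum_{w\in V}e^{\langle v_w,c\rangle},\qquad Z_{c,a}=\sum_{w\in V}e^{\langle c,v_w\rangle+T(v_a,v_w,c)} .$$ Conditionally on the discourse vectors, independently for each $t$: with probability $1-p_{syn}$ the vector $c_t$ generates a single word, equal to $w_t$ with probability $e^{\langle c_t,v_{w_t}\rangle}/Z_{c_t}$; with probability $p_{syn}\in(0,1)$ it generates a syntactic pair $(w_t,w_t')$,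 with probability $\frac{e^{\langle c_t,v_{w_t}\rangle}}{Z_{c_t}}\cdot\frac{e^{\langle c_t,v_{w_t'}\rangle+T(v_{w_t},v_{w_t'},c_t)}}{Z_{c_t,w_t}}$. Conditionally on the event that $c_t$ generates a single word and $c_{t+1}$ a syntactic pair, let $p(a)=\Pr[w_{t+1}=a]$, $p(w,a)=\Pr[w_t=w,w_{t+1}=a]$, $p([a,b])=\Pr[w_{t+1}=a,w_{t+1}'=b]$, $p(w,[a,b])=\Pr[w_t=w,w_{t+1}=a,w'_{t+1}=b]$. **Assumptions.** Let $K,R,C_1,c_1>0$, $\theta<1$ and $k\in\mathbb N$ be constants. Let $\epsilon\ge 0$, and suppose that: 1. $T$ is $(K,\epsilon)$-bounded: for all $a,b\in V$, $\|T(v_a,\cdot,\cdot)+I\|^2\le \frac{Kd\epsilon^2}{\log^2 n}$ (spectral norm), $\|T(v_a,\cdot,\cdot)+I\|_F^2\le Kd$ and $\|T(v_a,v_b,\cdot)\|^2\le Kd$; 2. $\|v_i\|\le R\sqrt d$ for every $i\in V$; 3. (concentration of $Z_c$) $Z>0$ and $0\le\epsilon_z\le\theta$ satisfy $\Pr_{c\sim\mathcal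 C}[(1-\epsilon_z)Z\le Z_c\le(1+\epsilon_z)Z]\ge 1-e^{-c_1\log^2 n}$, where $\epsilon_z\le C_1(1+\log n)^k/\sqrt n$; 4. (concentration of $Z_{c,a}$) for the word $a$ under consideration, $Z_a>0$ and $0\le\epsilon_{z,a}\le\theta$ satisfy $\Pr_{c\sim\mathcal C}[(1-\epsilon_{z,a})Z_a\le Z_{c,a}\le(1+\epsilon_{z,a})Z_a]\ge 1-e^{-c_1\log^2 n}$, where $\epsilon_{z,a}\le C_1\epsilon+C_1(1+\log n)^k/\sqrt n$. **Conclusion.** There are $C>0$ and $m\in\mathbb N$, depending only on $K,R,\theta,C_1,c_1,k$, such that for all $w,a,b\in V$ and all $t$ the four probabilities are positive and \begin{align*} \log p(a)&=\frac{\|v_a\|^2}{2d}-\log Z\pm\epsilon_p,\\ \log p(w,a)&=\frac{\|v_w+v_a\|^2}{2d}-2\log Z\pm\epsilon_p,\\ \log p([a,b])&=\frac{\|v_a+v_b+T(v_a,v_b,\cdot)\|^2}{2d}-\log Z-\log Z_a\pm\epsilon_p,\\ \log p(w,[a,b])&=\frac{\|v_w+v_a+v_b+T(v_a,v_b,\cdot)\|^2}{2d}-2\log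 Z-\log Z_a\pm\epsilon_p, \end{align*} where $x=y\pm\epsilon_p$ means $|x-y|\le\epsilon_p$ and $$\epsilon_p=C(\epsilon+\epsilon_w)+C\Big(\frac{(1+\log n)^m}{\sqrt n}+\frac{(1+\log d)^m}{d}\Big)=O(\epsilon+\epsilon_w)+\tilde O(1/\sqrt n+1/d).$$ -/

import Mathlib

open MeasureTheory ProbabilityTheory

noncomputable section

namespace SynRandWalk

/-- `ℝ^d` with the Euclidean norm. -/
abbrev Vec (d : ℕ) : Type := EuclideanSpace ℝ (Fin d)

/-- The unit sphere of `ℝ^d`. -/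
abbrev Sph (d : ℕ) : Type := Metric.sphere (0 : Vec d) 1

/-- Real `d × d × d` arrays. -/
abbrev Tensor (d : ℕ) : Type := Fin d → Fin d → Fin d → ℝ

/-- The uniform probability distribution on the unit sphere: normalized surface measure. -/
def uniformSphere (d : ℕ) : Measure (Sph d) :=
  ((volume : Measure (Vec d)).toSphere Set.univ)⁻¹ • (volume : Measure (Vec d)).toSphere

/-- The scalar `T(x, y, z)`. -/
def Tensor.app3 {d : ℕ} (T : Tensor d) (x y z : Vec d) : ℝ :=
  ∑ i, ∑ j, ∑ k, T i j k * x i * y j * z k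

/-- The vector `T(x, y, ·)`. -/
def Tensor.app2 {d : ℕ} (T : Tensor d) (x y : Vec d) : Vec d :=
  WithLp.toLp 2 fun k => ∑ i, ∑ j, T i j k * x i * y j

/-- The matrix `T(x, ·, ·)`. -/
def Tensor.app1 {d : ℕ} (T : Tensor d) (x : Vec d) : Matrix (Fin d) (Fin d) ℝ :=
  Matrix.of fun j k => ∑ i, T i j k * x i

section Model

variable {V : Type*} [Fintype V] {d : ℕ}

/-- `(K, ε)`-boundedness of the composition tensor `T` with respect to the embeddings `v`.
The first norm is the spectral norm, the double sum is the squared Frobenius norm. -/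
structure IsBounded (v : V → Vec d) (T : Tensor d) (K ε : ℝ) : Prop where
  spectral : ∀ a, ‖Matrix.toEuclideanCLM (n := Fin d) (𝕜 := ℝ) (T.app1 (v a) + 1)‖ ^ 2
    ≤ K * d * ε ^ 2 / Real.log (Fintype.card V) ^ 2
  frobenius : ∀ a, ∑ j, ∑ k, ((T.app1 (v a) + 1) j k) ^ 2 ≤ K * d
  vector : ∀ a b, ‖T.app2 (v a) (v b)‖ ^ 2 ≤ K * d

/-- The partition function `Z_c = ∑_w exp ⟨v_w, c⟩`. -/
def partition (v : V → Vec d) (c : Vec d) : ℝ :=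
  ∑ w, Real.exp (inner ℝ (v w) c)

/-- The partition function `Z_{c,a} = ∑_w exp (⟨c, v_w⟩ + T(v_a, v_w, c))`. -/
def partitionAt (v : V → Vec d) (T : Tensor d) (a : V) (c : Vec d) : ℝ :=
  ∑ w, Real.exp (inner ℝ c (v w) + T.app3 (v a) (v w) c)

/-- What a discourse vector generates: a single word, `Sum.inl w`, or a syntactic pair,
`Sum.inr (a, b)`, with root word `a` and second word `b`. -/
abbrev Emission (V : Type*) : Type _ := V ⊕ (V × V)

/-- The word `w_t`: the single word, or the root word of the pair. -/
def Emission.root {V : Type*} : Emission V → V := Sum.elim id Prod.fst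

/-- The probability that the discourse vector `c` generates a given emission. -/
def emissionProb (v : V → Vec d) (T : Tensor d) (pSyn : ℝ) (c : Vec d) : Emission V → ℝ
  | Sum.inl w => (1 - pSyn) * (Real.exp (inner ℝ c (v w)) / partition v c)
  | Sum.inr (a, b) => pSyn * (Real.exp (inner ℝ c (v a)) / partition v c) *
      (Real.exp (inner ℝ c (v b) + T.app3 (v a) (v b) c) / partitionAt v T a c)

variable {Ω : Type*} [MeasurableSpace Ω]

/-- `c` is a stationary Markov chain on the unit sphere with uniform stationary distribution
and steps of length at most `εw / √d`. -/
structure IsDiscourseWalk (P : Measure Ω) (c : ℕ → Ω → Sph d) (εw : ℝ) : Prop where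
  measurable : ∀ t, Measurable (c t)
  initial : P.map (c 0) = uniformSphere d
  markov : ∃ κ : Kernel (Sph d) (Sph d), IsMarkovKernel κ ∧ κ.Invariant (uniformSphere d) ∧
    ∀ (t : ℕ) (A : Set (Fin (t + 1) → Sph d)) (B : Set (Sph d)),
      MeasurableSet A → MeasurableSet B →
      P ({ω | (fun i : Fin (t + 1) => c i ω) ∈ A} ∩ {ω | c (t + 1) ω ∈ B}) =
        ∫⁻ ω in {ω | (fun i : Fin (t + 1) => c i ω) ∈ A}, κ (c t ω) B ∂P
  step_le : ∀ t, ∀ᵐ ω ∂P, ‖(c t ω : Vec d) - (c (t + 1) ω : Vec d)‖ ≤ εw / √(d : ℝ)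

/-- The syntactic random-walk model given the embeddings `v` and the tensor `T`: discourse
vectors `c t` and emissions `o t`, where, conditionally on the whole discourse sequence, the
emissions are independent and `o t` has distribution `emissionProb v T pSyn (c t)`. -/
structure IsModel (v : V → Vec d) (T : Tensor d) (pSyn εw : ℝ) (P : Measure Ω)
    (c : ℕ → Ω → Sph d) (o : ℕ → Ω → Emission V) : Prop where
  walk : IsDiscourseWalk P c εw
  measurable : ∀ t x, MeasurableSet (o t ⁻¹' {x})
  emission : ∀ (N : ℕ) (x : Fin N → Emission V) (A : Set (ℕ → Sph d)), MeasurableSet A →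
    P ({ω | (fun t => c t ω) ∈ A} ∩ {ω | ∀ i : Fin N, o i ω = x i}) =
      ∫⁻ ω in {ω | (fun t => c t ω) ∈ A},
        ENNReal.ofReal (∏ i : Fin N, emissionProb v T pSyn (c i ω) (x i)) ∂P

/-- The event that `c t` generates a single word and `c (t + 1)` a syntactic pair. -/
def singleThenPair (o : ℕ → Ω → Emission V) (t : ℕ) : Set Ω :=
  {ω | (o t ω).isLeft = true ∧ (o (t + 1) ω).isRight = true}

/-- `p(a) = Pr[w_{t+1} = a]`, conditionally on `singleThenPair o t`. -/
def probRoot (P : Measure Ω) (o : ℕ → Ω → Emission V) (t : ℕ) (a : V) : ℝ :=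
  (P[|singleThenPair o t]).real {ω | (o (t + 1) ω).root = a}

/-- `p(w, a) = Pr[w_t = w, w_{t+1} = a]`, conditionally on `singleThenPair o t`. -/
def probWordRoot (P : Measure Ω) (o : ℕ → Ω → Emission V) (t : ℕ) (w a : V) : ℝ :=
  (P[|singleThenPair o t]).real {ω | (o t ω).root = w ∧ (o (t + 1) ω).root = a}

/-- `p([a, b]) = Pr[w_{t+1} = a, w'_{t+1} = b]`, conditionally on `singleThenPair o t`. -/
def probPair (P : Measure Ω) (o : ℕ → Ω → Emission V) (t : ℕ) (a b : V) : ℝ :=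
  (P[|singleThenPair o t]).real {ω | o (t + 1) ω = Sum.inr (a, b)}

/-- `p(w, [a, b]) = Pr[w_t = w, w_{t+1} = a, w'_{t+1} = b]`, conditionally on
`singleThenPair o t`. -/
def probWordPair (P : Measure Ω) (o : ℕ → Ω → Emission V) (t : ℕ) (w a b : V) : ℝ :=
  (P[|singleThenPair o t]).real {ω | (o t ω).root = w ∧ o (t + 1) ω = Sum.inr (a, b)}

end Model

/-- For `c` uniform on the sphere, `(1 - η) Z ≤ F c ≤ (1 + η) Z` with probability at least
`1 - δ`. -/
def Concentrates {d : ℕ} (F : Vec d → ℝ) (Z η δ : ℝ) : Prop :=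
  0 < Z ∧ 1 - δ ≤ (uniformSphere d).real
    {c | (1 - η) * Z ≤ F (c : Vec d) ∧ F (c : Vec d) ≤ (1 + η) * Z}

/-- The factor `(1 + log x) ^ m`, through which soft-O bounds are expressed. -/
def polylog (m : ℕ) (x : ℝ) : ℝ := (1 + Real.log x) ^ m

/-- `log p = x ± η`, for a positive real `p`. -/
def LogApprox (p x η : ℝ) : Prop := 0 < p ∧ |Real.log p - x| ≤ η

end SynRandWalk

end

noncomputable section

namespace SynRandWalk

/-! ### Moments of linear forms on the sphere -/

/-! Each of the four conditional probabilities is the expectation of a product of at most three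
log-linear weights `exp ⟨y w, c⟩ / ∑ w', exp ⟨y w', c⟩`. Indeed `T(v_a, v_b, c)` is linear in `c`,
so it is absorbed into the vectors `pairVec`, and the conditioning event has the constant
probability `(1 - p) p`, which cancels. Evaluating the weight of the first word at `c (t + 1)`
instead of `c t` costs a factor `exp (O(εw))`, and `c (t + 1)` is uniform. Everything thus reduces
to one expectation over the sphere, `log_integral_wordsProb`.

Off a set of probability `O(δ)`, `δ = exp (-c₁ log² n)`, the product is `exp (⟨u, c⟩ ± O(∑ η)) / ∏
Z`, where `u` is the sum of the chosen vectors and `‖u‖ = O(√d)`. The main term is the Laplace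
transform of the sphere (`integral_exp_inner_bounds`): Gaussian integration by parts and polar
coordinates give a recursion for the moments of `⟨u, ·⟩`, and Jensen's inequality for Poisson
weights turns it into `exp (‖u‖² / (2d))` up to `exp (-O(1/d))`.

The exceptional set is treated separately on each side. From above, the product is at most `1` and
the main term is at least of order `n⁻ᵐ`, because every `Z` is `O(n)`, so the relative error is
`O(nᵐ δ)`. From below, a Cauchy-Schwarz type estimate loses `O(√δ)` when `δ` is small; otherwise a
crude harmonic-mean bound suffices, since the reciprocal of the product is itself a sum of
exponentials of linear forms. Both losses are `O(1 / √n)`. -/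

lemma abs_pow_le_factorial_mul_exp (j : ℕ) (t : ℝ) :
    |t| ^ j ≤ j.factorial * (Real.exp t + Real.exp (-t)) := by
  have h := Real.pow_div_factorial_le_exp |t| (abs_nonneg t) j
  rw [div_le_iff₀ (by positivity), mul_comm] at h
  refine h.trans ?_
  gcongr
  rcases abs_cases t with ⟨h, _⟩ | ⟨h, _⟩ <;> rw [h] <;> linarith [Real.exp_pos t, Real.exp_pos (-t)]

lemma integrable_exp_inner_sub_norm_sq {d : ℕ} (u : Vec d) :
    Integrable fun x : Vec d => Real.exp (inner ℝ u x - ‖x‖ ^ 2) := by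
  have h := (GaussianFourier.integrable_cexp_neg_mul_sq_norm_add (V := Vec d) (b := 1)
    (by simp) 1 u).re
  refine h.congr (ae_of_all _ fun x => ?_)
  have : (-1 : ℂ) * (‖x‖ : ℂ) ^ 2 + 1 * ((inner ℝ u x : ℝ) : ℂ)
      = ((inner ℝ u x - ‖x‖ ^ 2 : ℝ) : ℂ) := by push_cast; ring
  simp only [this]
  exact (Complex.exp_ofReal_re _)

lemma integrable_inner_pow_mul_exp {d : ℕ} (u : Vec d) (j : ℕ) :
    Integrable fun x : Vec d => (inner ℝ u x) ^ j * Real.exp (-‖x‖ ^ 2) := by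
  have h1 := integrable_exp_inner_sub_norm_sq u
  have h2 := integrable_exp_inner_sub_norm_sq (-u)
  refine ((h1.add h2).const_mul (j.factorial : ℝ)).mono' (by fun_prop) (ae_of_all _ fun x => ?_)
  rw [norm_mul, norm_pow, Real.norm_eq_abs, Real.norm_eq_abs, abs_of_pos (Real.exp_pos _)]
  calc |inner ℝ u x| ^ j * Real.exp (-‖x‖ ^ 2)
      ≤ j.factorial * (Real.exp (inner ℝ u x) + Real.exp (-inner ℝ u x)) * Real.exp (-‖x‖ ^ 2) := by
        gcongr; exact abs_pow_le_factorial_mul_exp j _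
    _ = _ := by
        simp only [Pi.add_apply, inner_neg_left, sub_eq_add_neg, Real.exp_add]; ring

/-- Gaussian integration by parts in the direction `u`: the derivative of `exp (-‖x‖²)` along `u` is
`-2 ⟨u, x⟩ exp (-‖x‖²)`. -/
lemma integral_inner_pow_add_two {d : ℕ} (u : Vec d) (j : ℕ) :
    2 * ∫ x : Vec d, (inner ℝ u x) ^ (j + 2) * Real.exp (-‖x‖ ^ 2)
      = (j + 1) * ‖u‖ ^ 2 * ∫ x : Vec d, (inner ℝ u x) ^ j * Real.exp (-‖x‖ ^ 2) := by
  have hg : ∀ x : Vec d, HasFDerivAt (fun x : Vec d => Real.exp (-‖x‖ ^ 2))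
      (Real.exp (-‖x‖ ^ 2) • (-((2 : ℕ) • (innerSL ℝ x : Vec d →L[ℝ] ℝ)))) x := fun x =>
    ((hasStrictFDerivAt_norm_sq x).hasFDerivAt.neg).exp
  have hf : ∀ x : Vec d, HasFDerivAt (fun x : Vec d => (inner ℝ u x) ^ (j + 1))
      (((j + 1 : ℕ) : ℝ) • (inner ℝ u x) ^ j • (innerSL ℝ u)) x := fun x => by
    have := ((innerSL ℝ u).hasFDerivAt (x := x)).pow (j + 1)
    simpa [smul_smul, nsmul_eq_mul] using this
  have hg' : ∀ x, fderiv ℝ (fun x : Vec d => Real.exp (-‖x‖ ^ 2)) x u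
      = -2 * inner ℝ u x * Real.exp (-‖x‖ ^ 2) := fun x => by
    rw [(hg x).fderiv]; simp [real_inner_comm]; ring
  have hf' : ∀ x, fderiv ℝ (fun x : Vec d => (inner ℝ u x) ^ (j + 1)) x u
      = (j + 1) * ‖u‖ ^ 2 * (inner ℝ u x) ^ j := fun x => by
    rw [(hf x).fderiv]; simp; ring
  have key := integral_mul_fderiv_eq_neg_fderiv_mul_of_integrable (μ := (volume : Measure (Vec d)))
    (f := fun x : Vec d => (inner ℝ u x) ^ (j + 1)) (g := fun x : Vec d => Real.exp (-‖x‖ ^ 2))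
    (v := u) ?_ ?_ ?_ (fun x _ => (hf x).differentiableAt) (fun x _ => (hg x).differentiableAt)
  · simp only [hg', hf'] at key
    rw [← integral_const_mul, ← integral_const_mul]
    have e1 : ∀ x : Vec d, (inner ℝ u x) ^ (j + 1) * (-2 * inner ℝ u x * Real.exp (-‖x‖ ^ 2))
        = - (2 * ((inner ℝ u x) ^ (j + 2) * Real.exp (-‖x‖ ^ 2))) := fun x => by ring
    simp only [e1, integral_neg, neg_inj] at key
    rw [key]
    congr 1; ext x; ring
  · simp only [hf']
    exact ((integrable_inner_pow_mul_exp u j).const_mul ((j + 1) * ‖u‖ ^ 2)).congr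
      (ae_of_all _ fun x => by ring)
  · simp only [hg']
    exact ((integrable_inner_pow_mul_exp u (j + 2)).const_mul (-2)).congr
      (ae_of_all _ fun x => by ring)
  · exact integrable_inner_pow_mul_exp u (j + 1)

/-- Half of `Γ((d + j) / 2)`: the radial factor of the `j`-th Gaussian moment. -/
def radial (d j : ℕ) : ℝ := 1 / 2 * Real.Gamma ((d + j : ℝ) / 2)

lemma radial_pos {d : ℕ} (hd : 1 ≤ d) (j : ℕ) : 0 < radial d j := by
  have : (0 : ℝ) < d := by exact_mod_cast hd
  have := Real.Gamma_pos_of_pos (s := (d + j : ℝ) / 2) (by positivity)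
  unfold radial; positivity

lemma radial_add_two {d : ℕ} (hd : 1 ≤ d) (j : ℕ) :
    radial d (j + 2) = (d + j) / 2 * radial d j := by
  have : (0 : ℝ) < d := by exact_mod_cast hd
  have h := Real.Gamma_add_one (s := (d + j : ℝ) / 2) (by positivity)
  unfold radial
  rw [show ((d : ℝ) + ((j + 2 : ℕ) : ℝ)) / 2 = (d + j : ℝ) / 2 + 1 by push_cast; ring, h]
  ring

lemma integral_volumeIoiPow {d : ℕ} (hd : 1 ≤ d) (j : ℕ) :
    ∫ r : Set.Ioi (0 : ℝ), (r : ℝ) ^ j * Real.exp (-(r : ℝ) ^ 2) ∂(Measure.volumeIoiPow (d - 1))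
      = radial d j := by
  have h0 : (0 : ℝ) < d := by exact_mod_cast hd
  simp only [Measure.volumeIoiPow, ENNReal.ofReal]
  rw [integral_withDensity_eq_integral_smul ((measurable_subtype_coe.pow_const _).real_toNNReal),
    integral_subtype_comap measurableSet_Ioi fun a : ℝ =>
      Real.toNNReal (a ^ (d - 1)) • (a ^ j * Real.exp (-a ^ 2))]
  have := integral_rpow_mul_exp_neg_rpow (p := 2) (q := d - 1 + j) two_pos (by
    have : (0 : ℝ) ≤ j := by positivity
    linarith)
  rw [show (d - 1 + j + 1 : ℝ) / 2 = (d + j) / 2 by ring] at this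
  rw [radial, ← this]
  refine setIntegral_congr_fun measurableSet_Ioi fun x hx => ?_
  have hx0 : (0 : ℝ) < x := hx
  simp only [NNReal.smul_def, Real.coe_toNNReal _ (pow_nonneg hx0.le _), smul_eq_mul]
  rw [← mul_assoc, ← pow_add, ← Real.rpow_natCast, ← Real.rpow_natCast]
  push_cast [Nat.cast_sub hd]
  norm_num

/-- In polar coordinates a form homogeneous of degree `j` splits into its restriction to the sphere
and `r ^ j`, so Gaussian moments and sphere moments differ only by a radial factor independent of
`u`. -/
lemma integral_inner_pow_polar {d : ℕ} (hd : 1 ≤ d) (u : Vec d) (j : ℕ) :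
    ∫ x : Vec d, (inner ℝ u x) ^ j * Real.exp (-‖x‖ ^ 2)
      = (∫ c : Sph d, (inner ℝ u (c : Vec d)) ^ j ∂(volume : Measure (Vec d)).toSphere)
        * radial d j := by
  have : Nonempty (Fin d) := ⟨⟨0, hd⟩⟩
  have : Nontrivial (Vec d) := inferInstance
  set F : Vec d → ℝ := fun x => (inner ℝ u x) ^ j * Real.exp (-‖x‖ ^ 2)
  calc ∫ x, F x = ∫ x : ({0}ᶜ : Set (Vec d)), F (x : Vec d) ∂((volume : Measure (Vec d)).comap Subtype.val) := by
        rw [integral_subtype_comap (measurableSet_singleton _).compl F,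
          restrict_compl_singleton]
    _ = ∫ x : Sph d × Set.Ioi (0 : ℝ), F ((x.2 : ℝ) • (x.1 : Vec d))
          ∂(volume : Measure (Vec d)).toSphere.prod (.volumeIoiPow (d - 1)) := by
        have := (volume : Measure (Vec d)).measurePreserving_homeomorphUnitSphereProd.integral_comp
          (Homeomorph.measurableEmbedding _)
          (fun x : Sph d × Set.Ioi (0 : ℝ) => F ((x.2 : ℝ) • (x.1 : Vec d)))
        rw [finrank_euclideanSpace_fin] at this
        rw [← this]
        congr 1; ext x
        congr 1
        have hx : ‖(x : Vec d)‖ ≠ 0 := norm_ne_zero_iff.2 x.2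
        simp [smul_smul, hx]
    _ = ∫ x : Sph d × Set.Ioi (0 : ℝ), (inner ℝ u (x.1 : Vec d)) ^ j *
          ((x.2 : ℝ) ^ j * Real.exp (-(x.2 : ℝ) ^ 2))
          ∂(volume : Measure (Vec d)).toSphere.prod (.volumeIoiPow (d - 1)) := by
        congr 1; ext x
        have h1 : ‖(x.1 : Vec d)‖ = 1 := by simp
        simp only [F, inner_smul_right, norm_smul, h1, mul_pow, Real.norm_eq_abs, sq_abs]
        ring_nf
    _ = _ := by rw [integral_prod_mul
          (f := fun c : Sph d => (inner ℝ u (c : Vec d)) ^ j)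
          (g := fun r : Set.Ioi (0 : ℝ) => (r : ℝ) ^ j * Real.exp (-(r : ℝ) ^ 2)),
          integral_volumeIoiPow hd]

lemma isProbabilityMeasure_uniformSphere {d : ℕ} (hd : 1 ≤ d) :
    IsProbabilityMeasure (uniformSphere d) := by
  have : Nonempty (Fin d) := ⟨⟨0, hd⟩⟩
  have : Nontrivial (Vec d) := inferInstance
  refine ⟨?_⟩
  rw [uniformSphere, Measure.smul_apply, smul_eq_mul]
  exact ENNReal.inv_mul_cancel (by
    rw [Ne, Measure.measure_univ_eq_zero]
    exact Measure.toSphere_ne_zero (volume : Measure (Vec d))) (measure_ne_top _ _)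

/-- The moments of a linear form under the uniform distribution on the sphere. -/
def moment {d : ℕ} (u : Vec d) (j : ℕ) : ℝ :=
  ∫ c : Sph d, (inner ℝ u (c : Vec d)) ^ j ∂(uniformSphere d)

lemma moment_zero {d : ℕ} (hd : 1 ≤ d) (u : Vec d) : moment u 0 = 1 := by
  have := isProbabilityMeasure_uniformSphere hd
  simp [moment]

/-- The Gaussian recursion divided by the recursion of the Gamma factor; the `d + j` on the left
comes from `Γ(x + 1) = x Γ(x)`. -/
lemma moment_add_two {d : ℕ} (hd : 1 ≤ d) (u : Vec d) (j : ℕ) :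
    (d + j) * moment u (j + 2) = (j + 1) * ‖u‖ ^ 2 * moment u j := by
  have h := integral_inner_pow_add_two u j
  rw [integral_inner_pow_polar hd, integral_inner_pow_polar hd, radial_add_two hd] at h
  have hr := radial_pos hd j
  simp only [moment, uniformSphere, integral_smul_measure, smul_eq_mul]
  have h2 : (d + j) * (∫ c : Sph d, (inner ℝ u (c : Vec d)) ^ (j + 2)
      ∂(volume : Measure (Vec d)).toSphere) = (j + 1) * ‖u‖ ^ 2 *
      ∫ c : Sph d, (inner ℝ u (c : Vec d)) ^ j ∂(volume : Measure (Vec d)).toSphere := by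
    apply mul_right_cancel₀ hr.ne'
    linarith
  rw [mul_left_comm, h2]; ring

lemma moment_one {d : ℕ} (hd : 1 ≤ d) (u : Vec d) : moment u 1 = 0 := by
  have h := integral_neg_eq_self (fun x : Vec d => (inner ℝ u x) ^ 1 * Real.exp (-‖x‖ ^ 2)) volume
  simp only [inner_neg_right, norm_neg, pow_one, neg_mul, integral_neg] at h
  have h0 : ∫ x : Vec d, (inner ℝ u x) ^ 1 * Real.exp (-‖x‖ ^ 2) = 0 := by
    simp only [pow_one]; linarith
  rw [integral_inner_pow_polar hd] at h0
  have := (mul_eq_zero.1 h0).resolve_right (radial_pos hd 1).ne'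
  rw [moment, uniformSphere, integral_smul_measure, this, smul_zero]

lemma moment_odd {d : ℕ} (hd : 1 ≤ d) (u : Vec d) (k : ℕ) : moment u (2 * k + 1) = 0 := by
  induction k with
  | zero => simpa using moment_one hd u
  | succ k ih =>
    have h := moment_add_two hd u (2 * k + 1)
    have h0 : (0 : ℝ) < d := by exact_mod_cast hd
    rw [ih, mul_zero] at h
    exact (mul_eq_zero.1 h).resolve_left (by positivity)

lemma abs_inner_sphere_le {d : ℕ} (u : Vec d) (c : Sph d) : |inner ℝ u (c : Vec d)| ≤ ‖u‖ := by
  have h1 : ‖(c : Vec d)‖ = 1 := by simp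
  simpa [h1] using abs_real_inner_le_norm u (c : Vec d)

lemma hasSum_moment {d : ℕ} (hd : 1 ≤ d) (u : Vec d) :
    HasSum (fun j => moment u j / j.factorial)
      (∫ c : Sph d, Real.exp (inner ℝ u (c : Vec d)) ∂(uniformSphere d)) := by
  have := isProbabilityMeasure_uniformSphere hd
  have hb : ∀ (j : ℕ) (c : Sph d), ‖(inner ℝ u (c : Vec d)) ^ j / (j.factorial : ℝ)‖
      ≤ ‖u‖ ^ j / j.factorial := fun j c => by
    rw [norm_div, norm_pow, Real.norm_eq_abs, RCLike.norm_natCast]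
    gcongr
    exact abs_inner_sphere_le u c
  have hI : ∀ j : ℕ, Integrable (fun c : Sph d => (inner ℝ u (c : Vec d)) ^ j / (j.factorial : ℝ))
      (uniformSphere d) := fun j =>
    Integrable.of_bound (by fun_prop) _ (ae_of_all _ (hb j))
  have h := hasSum_integral_of_summable_integral_norm hI ?_
  · convert! h using 1
    · ext j; rw [moment, integral_div]
    · congr 1; ext c
      rw [Real.exp_eq_exp_ℝ, NormedSpace.exp_eq_tsum_div]
  · refine Summable.of_nonneg_of_le (fun j => integral_nonneg fun _ => norm_nonneg _)
      (fun j => ?_) (Real.summable_pow_div_factorial ‖u‖)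
    calc _ ≤ ∫ _ : Sph d, ‖u‖ ^ j / (j.factorial : ℝ) ∂(uniformSphere d) :=
          integral_mono (hI j).norm (integrable_const _) (hb j)
      _ = _ := by simp

lemma hasSum_moment_even {d : ℕ} (hd : 1 ≤ d) (u : Vec d) :
    HasSum (fun k => moment u (2 * k) / (2 * k).factorial)
      (∫ c : Sph d, Real.exp (inner ℝ u (c : Vec d)) ∂(uniformSphere d)) := by
  have hinj : Function.Injective (fun k : ℕ => 2 * k) := fun a b h => by simpa using h
  refine (hinj.hasSum_iff (f := fun j => moment u j / (j.factorial : ℝ)) ?_).2 (hasSum_moment hd u)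
  intro j hj
  obtain ⟨k, rfl | rfl⟩ := Nat.even_or_odd' j
  · exact absurd ⟨k, rfl⟩ hj
  · simp [moment_odd hd]

/-- By the recursion, consecutive terms have ratio `s / (k + 1)` times `1 / (1 + 2k/d)`, where `s =
‖u‖² / (2d)`. The last factor lies between `exp (-2k/d)` and `1`, and the exponents `2i/d` for `i <
k` add up to `k (k - 1) / d`. -/
lemma moment_even_bounds {d : ℕ} (hd : 1 ≤ d) (u : Vec d) (k : ℕ) :
    (‖u‖ ^ 2 / (2 * d)) ^ k / k.factorial * Real.exp (-(k * (k - 1) / d))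
        ≤ moment u (2 * k) / (2 * k).factorial ∧
      moment u (2 * k) / (2 * k).factorial ≤ (‖u‖ ^ 2 / (2 * d)) ^ k / k.factorial := by
  have h0 : (0 : ℝ) < d := by exact_mod_cast hd
  induction k with
  | zero => simp [moment_zero hd]
  | succ k ih =>
    set s := ‖u‖ ^ 2 / (2 * d) with hs
    have hs0 : 0 ≤ s := by positivity
    have hrec : moment u (2 * (k + 1)) / (2 * (k + 1)).factorial
        = moment u (2 * k) / (2 * k).factorial * (s / (k + 1)) * (1 / (1 + 2 * k / d)) := by
      have h := moment_add_two hd u (2 * k)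
      rw [show 2 * (k + 1) = 2 * k + 2 by ring]
      rw [Nat.factorial_succ, Nat.factorial_succ, hs]
      have hm : moment u (2 * k + 2) = (2 * k + 1) * ‖u‖ ^ 2 * moment u (2 * k) / (d + 2 * k) := by
        rw [eq_div_iff (by positivity)]; push_cast at h; linarith
      rw [hm]; push_cast; field_simp; ring
    have ht : s ^ (k + 1) / (k + 1).factorial = s ^ k / k.factorial * (s / (k + 1)) := by
      rw [Nat.factorial_succ, pow_succ]; push_cast; field_simp
    rw [hrec, ht]
    have hb0 : 0 ≤ moment u (2 * k) / (2 * k).factorial := le_trans (by positivity) ih.1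
    constructor
    · have he : Real.exp (-(((k + 1 : ℕ) : ℝ) * (((k + 1 : ℕ) : ℝ) - 1) / d))
          = Real.exp (-(k * (k - 1) / d)) * Real.exp (-(2 * k / d)) := by
        rw [← Real.exp_add]; congr 1; push_cast; ring
      have hx : Real.exp (-(2 * k / d)) ≤ 1 / (1 + 2 * k / d) := by
        rw [Real.exp_neg, ← one_div]
        gcongr
        linarith [Real.add_one_le_exp (2 * k / d : ℝ)]
      rw [he]
      calc _ = (s ^ k / k.factorial * Real.exp (-(k * (k - 1) / d))) * (s / (k + 1))
              * Real.exp (-(2 * k / d)) := by ring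
        _ ≤ _ := by gcongr; exact ih.1
    · have : 1 / (1 + 2 * k / d : ℝ) ≤ 1 := by
        rw [div_le_one (by positivity)]
        have : (0 : ℝ) ≤ 2 * k / d := by positivity
        linarith
      calc _ ≤ moment u (2 * k) / (2 * k).factorial * (s / (k + 1)) * 1 := by gcongr
        _ ≤ _ := by rw [mul_one]; exact mul_le_mul_of_nonneg_right ih.2 (by positivity)

lemma hasSum_pow_div_factorial (s : ℝ) :
    HasSum (fun k : ℕ => s ^ k / k.factorial) (Real.exp s) := by
  rw [Real.exp_eq_exp_ℝ]; exact NormedSpace.expSeries_div_hasSum_exp s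

/-- The second factorial moment of the Poisson law, without its normalization `exp (-s)`. -/
lemma hasSum_pow_div_factorial_mul (s : ℝ) :
    HasSum (fun k : ℕ => s ^ k / k.factorial * (k * (k - 1))) (s ^ 2 * Real.exp s) := by
  rw [← hasSum_nat_add_iff' 2]
  simp only [Finset.sum_range_succ, Finset.sum_range_zero]
  norm_num
  convert! (hasSum_pow_div_factorial s).mul_left (s ^ 2) using 2 with k
  rw [Nat.factorial_succ, Nat.factorial_succ]
  push_cast
  field_simp
  ring

/-- The Laplace transform of the uniform distribution on the sphere is Gaussian up to a factor
`exp (-s ^ 2 / d)`. -/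
theorem integral_exp_inner_bounds {d : ℕ} (hd : 1 ≤ d) (u : Vec d) :
    Real.exp (‖u‖ ^ 2 / (2 * d) - (‖u‖ ^ 2 / (2 * d)) ^ 2 / d)
        ≤ ∫ c : Sph d, Real.exp (inner ℝ u (c : Vec d)) ∂(uniformSphere d) ∧
      ∫ c : Sph d, Real.exp (inner ℝ u (c : Vec d)) ∂(uniformSphere d)
        ≤ Real.exp (‖u‖ ^ 2 / (2 * d)) := by
  have h0 : (0 : ℝ) < d := by exact_mod_cast hd
  set s := ‖u‖ ^ 2 / (2 * d)
  have hs0 : 0 ≤ s := by positivity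
  refine ⟨?_, hasSum_le (fun k => (moment_even_bounds hd u k).2) (hasSum_moment_even hd u)
    (hasSum_pow_div_factorial s)⟩
  -- Jensen's inequality for the Poisson weights `s ^ k / k!`: `exp (-x / d)` is replaced by its
  -- tangent at `x = s²`, which is the Poisson mean of `k (k - 1)`, so the linear terms cancel after
  -- summation.
  have hsum : HasSum (fun k : ℕ => Real.exp (-(s ^ 2 / d)) *
      ((1 + s ^ 2 / d) * (s ^ k / k.factorial) - 1 / d * (s ^ k / k.factorial * (k * (k - 1)))))
      (Real.exp (-(s ^ 2 / d)) * ((1 + s ^ 2 / d) * Real.exp s - 1 / d * (s ^ 2 * Real.exp s))) :=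
    (((hasSum_pow_div_factorial s).mul_left _).sub
      ((hasSum_pow_div_factorial_mul s).mul_left _)).mul_left _
  have hle := hasSum_le (fun k => ?_) hsum (hasSum_moment_even hd u)
  · convert! hle using 1
    rw [sub_eq_add_neg, Real.exp_add]; ring
  · refine le_trans ?_ (moment_even_bounds hd u k).1
    have ht : Real.exp (-(s ^ 2 / d)) * (1 - (k * (k - 1) - s ^ 2) / d)
        ≤ Real.exp (-((k : ℝ) * (k - 1) / d)) := by
      have := Real.add_one_le_exp (-(((k : ℝ) * (k - 1) - s ^ 2) / d))
      calc _ ≤ Real.exp (-(s ^ 2 / d)) * Real.exp (-(((k : ℝ) * (k - 1) - s ^ 2) / d)) := by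
            gcongr; linarith
        _ = _ := by rw [← Real.exp_add]; congr 1; ring
    calc _ = s ^ k / k.factorial * (Real.exp (-(s ^ 2 / d)) * (1 - (k * (k - 1) - s ^ 2) / d)) := by
          ring
      _ ≤ _ := by gcongr

/-! ### Expectations of nearly log-linear probabilities -/

lemma one_sub_ge_exp_neg_two_mul {r : ℝ} (h0 : 0 ≤ r) (h : r ≤ 1 / 2) :
    Real.exp (-(2 * r)) ≤ 1 - r := by
  rw [Real.exp_neg, inv_le_comm₀ (Real.exp_pos _) (by linarith), ← one_div,
    div_le_iff₀ (by linarith)]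
  have := Real.add_one_le_exp (2 * r)
  calc (1 : ℝ) ≤ (2 * r + 1) * (1 - r) := by nlinarith
    _ ≤ _ := by gcongr; linarith

/-- The mean of a positive function is at least its harmonic mean. -/
lemma inv_le_integral_of_integral_inv_le {α : Type*} [MeasurableSpace α] (σ : Measure α)
    [IsProbabilityMeasure σ] {q : α → ℝ} {Q : ℝ} (hq0 : ∀ x, 0 < q x) (hqi : Integrable q σ)
    (hQi : Integrable (fun x => (q x)⁻¹) σ) (hQ : ∫ x, (q x)⁻¹ ∂σ ≤ Q) (hQ0 : 0 < Q) :
    Q⁻¹ ≤ ∫ x, q x ∂σ := by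
  -- The convex function `1 / y` of `y = q⁻¹` lies above its tangent at `y = Q`.
  have h : ∫ x, (2 * Q⁻¹ - Q⁻¹ ^ 2 * (q x)⁻¹) ∂σ ≤ ∫ x, q x ∂σ := by
    refine integral_mono ((integrable_const _).sub (hQi.const_mul _)) hqi fun x => ?_
    have hx := hq0 x
    have : q x - (2 * Q⁻¹ - Q⁻¹ ^ 2 * (q x)⁻¹) = (q x)⁻¹ * (q x - Q⁻¹) ^ 2 := by
      field_simp; ring
    have h2 : 0 ≤ (q x)⁻¹ * (q x - Q⁻¹) ^ 2 := by positivity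
    show 2 * Q⁻¹ - Q⁻¹ ^ 2 * (q x)⁻¹ ≤ q x
    linarith
  rw [integral_sub (integrable_const _) (hQi.const_mul _),
    integral_const_mul (Q⁻¹ ^ 2) fun x => (q x)⁻¹] at h
  simp only [integral_const, probReal_univ, smul_eq_mul, one_mul] at h
  have h3 : Q⁻¹ ^ 2 * ∫ x, (q x)⁻¹ ∂σ ≤ Q⁻¹ ^ 2 * Q := by gcongr
  have h4 : Q⁻¹ ^ 2 * Q = Q⁻¹ := by field_simp
  linarith

section LogLinear

variable {α : Type*} [MeasurableSpace α] (σ : Measure α) [IsProbabilityMeasure σ]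
  {X q : α → ℝ} {G : Set α} {s τ a D δ : ℝ}

/-- If `q ≤ 1` is at most `exp (X + a) / D` off a set of probability `δ`, then `log E q` is at most
`s - log D + a + δ D`. -/
lemma log_integral_le (hqi : Integrable q σ) (hq1 : ∀ x, q x ≤ 1) (hpos : 0 < ∫ x, q x ∂σ)
    (hG : MeasurableSet G) (hδ : σ.real Gᶜ ≤ δ) (hD : 0 < D) (ha : 0 ≤ a) (hs : 0 ≤ s)
    (hXi : Integrable (fun x => Real.exp (X x)) σ) (hM : ∫ x, Real.exp (X x) ∂σ ≤ Real.exp s)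
    (hup : ∀ x ∈ G, q x ≤ Real.exp (X x + a) / D) :
    Real.log (∫ x, q x ∂σ) ≤ s - Real.log D + a + δ * D := by
  have hδ0 : 0 ≤ δ := le_trans measureReal_nonneg hδ
  have hind : Integrable (Gᶜ.indicator (fun _ => (1 : ℝ))) σ :=
    (integrable_const _).indicator hG.compl
  have h : ∫ x, q x ∂σ ≤ ∫ x, (Real.exp a / D * Real.exp (X x)
      + Gᶜ.indicator (fun _ => (1 : ℝ)) x) ∂σ := by
    refine integral_mono hqi ((hXi.const_mul _).add hind) fun x => ?_
    by_cases hx : x ∈ G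
    · have := hup x hx
      simp only [Set.mem_compl_iff, hx, not_true_eq_false, not_false_eq_true,
        Set.indicator_of_notMem]
      rw [Real.exp_add] at this
      calc q x ≤ _ := this
        _ = _ := by ring
    · simp only [Set.mem_compl_iff, hx, not_false_eq_true, Set.indicator_of_mem]
      have : 0 ≤ Real.exp a / D * Real.exp (X x) := by positivity
      linarith [hq1 x]
  rw [integral_add (hXi.const_mul _) hind, integral_const_mul,
    integral_indicator_const _ hG.compl, smul_eq_mul, mul_one] at h
  -- Since `exp (a + s) ≥ 1`, the additive error `δ` becomes the relative error `δ D`.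
  have h2 : ∫ x, q x ∂σ ≤ Real.exp (a + s) / D * (1 + δ * D) := by
    calc _ ≤ _ := h
      _ ≤ Real.exp a / D * Real.exp s + δ := by gcongr
      _ = Real.exp (a + s) / D + 1 * δ := by rw [Real.exp_add]; ring
      _ ≤ Real.exp (a + s) / D + Real.exp (a + s) * δ := by
          gcongr; exact Real.one_le_exp (by linarith)
      _ = _ := by field_simp
  have h3 : ∫ x, q x ∂σ ≤ Real.exp (a + s) / D * Real.exp (δ * D) := h2.trans (by
    gcongr; linarith [Real.add_one_le_exp (δ * D)])
  have h4 := Real.log_le_log hpos h3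
  rw [Real.log_mul (by positivity) (by positivity), Real.log_div (by positivity) hD.ne',
    Real.log_exp, Real.log_exp] at h4
  linarith

/-- If `q` is at least `exp (X - a) / D` off a set of probability `δ`, then `log E q` is at least
`s - log D - a - τ` up to a multiple of `√δ`. -/
lemma le_log_integral {B Q e : ℝ} (hq0 : ∀ x, 0 < q x) (hqi : Integrable q σ)
    (hG : MeasurableSet G) (hδ0 : 0 < δ) (hδ : σ.real Gᶜ ≤ δ) (hD : 0 < D) (ha : 0 ≤ a)
    (hs : 0 ≤ s) (hτ : 0 ≤ τ)
    (hXi : Integrable (fun x => Real.exp (X x)) σ)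
    (hXi2 : Integrable (fun x => Real.exp (2 * X x)) σ)
    (hM : Real.exp (s - τ) ≤ ∫ x, Real.exp (X x) ∂σ) (hM1 : 1 ≤ ∫ x, Real.exp (X x) ∂σ)
    (hB : ∫ x, Real.exp (2 * X x) ∂σ ≤ B)
    (hQi : Integrable (fun x => (q x)⁻¹) σ) (hQ : ∫ x, (q x)⁻¹ ∂σ ≤ Q) (hQ0 : 0 < Q)
    (hQD : Q ≤ Real.exp e * D) (he : 0 ≤ e)
    (hlo : ∀ x ∈ G, Real.exp (X x - a) / D ≤ q x) :
    s - Real.log D - (a + τ + (B + 1) * (1 + e + s) * √δ) ≤ Real.log (∫ x, q x ∂σ) := by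
  set r := √δ with hr
  have hr0 : 0 < r := Real.sqrt_pos.2 hδ0
  have hrr : r * r = δ := Real.mul_self_sqrt hδ0.le
  have hB0 : 0 ≤ B := le_trans (integral_nonneg fun x => (Real.exp_pos _).le) hB
  have hQpos := inv_le_integral_of_integral_inv_le σ hq0 hqi hQi hQ hQ0
  have hpos : 0 < ∫ x, q x ∂σ := lt_of_lt_of_le (by positivity) hQpos
  set ρ := r * (B + 1) / 2 with hρ
  have hρ0 : 0 < ρ := by positivity
  have hlogD : Real.log Q ≤ e + Real.log D := by
    have := Real.log_le_log hQ0 hQD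
    rwa [Real.log_mul (by positivity) hD.ne', Real.log_exp] at this
  rcases le_or_gt ρ (1 / 2) with hsmall | hbig
  -- Small `δ`. The inequality `exp X ≤ (r / 2) exp (2X) + 1 / (2r)` makes the minorant below
  -- nonpositive off `G`; with `r = √δ` it plays the role of Cauchy-Schwarz for the part of `E exp
  -- X` lost off `G`, which is at most `ρ`.
  · have hind : Integrable (Gᶜ.indicator (fun _ => (1 / (2 * r) : ℝ))) σ :=
      (integrable_const _).indicator hG.compl
    have h : ∫ x, (Real.exp (-a) / D * (Real.exp (X x) - r / 2 * Real.exp (2 * X x)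
        - Gᶜ.indicator (fun _ => (1 / (2 * r) : ℝ)) x)) ∂σ ≤ ∫ x, q x ∂σ := by
      refine integral_mono (((hXi.sub (hXi2.const_mul _)).sub hind).const_mul _) hqi fun x => ?_
      have hsq : Real.exp (2 * X x) = Real.exp (X x) ^ 2 := by rw [← Real.exp_nat_mul]; norm_num
      by_cases hx : x ∈ G
      · simp only [Set.mem_compl_iff, hx, not_true_eq_false, not_false_eq_true,
          Set.indicator_of_notMem]
        calc _ ≤ Real.exp (-a) / D * Real.exp (X x) := by
              gcongr
              have : 0 ≤ r / 2 * Real.exp (2 * X x) := by positivity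
              linarith
          _ = Real.exp (X x - a) / D := by rw [sub_eq_add_neg, Real.exp_add]; ring
          _ ≤ _ := hlo x hx
      · simp only [Set.mem_compl_iff, hx, not_false_eq_true, Set.indicator_of_mem]
        refine le_trans ?_ (hq0 x).le
        refine mul_nonpos_of_nonneg_of_nonpos (by positivity) ?_
        have : Real.exp (X x) - r / 2 * Real.exp (2 * X x) - 1 / (2 * r)
            = -((r * Real.exp (X x) - 1) ^ 2 / (2 * r)) := by
          rw [hsq]; field_simp; ring
        rw [this, neg_nonpos]; positivity
    have hsub : Integrable (fun x => Real.exp (X x) - r / 2 * Real.exp (2 * X x)) σ :=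
      hXi.sub (hXi2.const_mul _)
    rw [integral_const_mul, integral_sub hsub hind,
      integral_sub hXi (hXi2.const_mul _), integral_const_mul,
      integral_indicator_const _ hG.compl, smul_eq_mul] at h
    set A := ∫ x, Real.exp (X x) ∂σ
    have h1 : A * Real.exp (-(2 * ρ)) ≤ A - r / 2 * (∫ x, Real.exp (2 * X x) ∂σ)
        - σ.real Gᶜ * (1 / (2 * r)) := by
      have e1 : r / 2 * (∫ x, Real.exp (2 * X x) ∂σ) ≤ r / 2 * B := by gcongr
      have e2 : σ.real Gᶜ * (1 / (2 * r)) ≤ r / 2 := by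
        calc _ ≤ δ * (1 / (2 * r)) := by gcongr
          _ = r / 2 := by rw [← hrr]; field_simp
      have e3 := one_sub_ge_exp_neg_two_mul hρ0.le hsmall
      have e4 : A * Real.exp (-(2 * ρ)) ≤ A * (1 - ρ) := by gcongr
      -- As `E exp X ≥ 1`, the additive loss `ρ` is also a relative one.
      have e5 : ρ ≤ A * ρ := by nlinarith
      have e6 : ρ = r / 2 * B + r / 2 := by rw [hρ]; ring
      linarith
    have h2 : Real.exp (-a) / D * (Real.exp (s - τ) * Real.exp (-(2 * ρ))) ≤ ∫ x, q x ∂σ := by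
      refine le_trans ?_ h
      gcongr
      refine le_trans ?_ h1
      gcongr
    have h3 := Real.log_le_log (by positivity) h2
    rw [Real.log_mul (by positivity) (by positivity), Real.log_div (by positivity) hD.ne',
      Real.log_mul (by positivity) (by positivity), Real.log_exp, Real.log_exp, Real.log_exp] at h3
    have h4 : 2 * ρ ≤ (B + 1) * (1 + e + s) * r := by
      have : 0 ≤ (B + 1) * (e + s) * r := by positivity
      rw [hρ]; linarith
    linarith
  -- Large `δ`: here `(B + 1) r > 1`, so the error term already exceeds `e + s`, the whole gap left
  -- by the harmonic-mean bound `1 / Q`.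
  · have h3 := Real.log_le_log (by positivity) hQpos
    rw [Real.log_inv] at h3
    have h4 : e + s ≤ (B + 1) * (1 + e + s) * r := by
      have h5 : 1 ≤ (B + 1) * r := by rw [hρ] at hbig; linarith
      have h6 : 1 * (1 + e + s) ≤ (B + 1) * r * (1 + e + s) := by gcongr
      linarith
    linarith

end LogLinear

/-! ### Normalized exponential weights on the sphere -/

/-- The sum of the exponentials of the linear forms `⟨y w, ·⟩`. -/
def expSum {V : Type*} [Fintype V] {d : ℕ} (y : V → Vec d) (c : Vec d) : ℝ :=
  ∑ w, Real.exp (inner ℝ (y w) c)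

lemma expSum_pos {V : Type*} [Fintype V] [Nonempty V] {d : ℕ} (y : V → Vec d) (c : Vec d) :
    0 < expSum y c := Finset.sum_pos (fun _ _ => Real.exp_pos _) Finset.univ_nonempty

lemma continuous_expSum {V : Type*} [Fintype V] {d : ℕ} (y : V → Vec d) :
    Continuous (expSum y) := by unfold expSum; fun_prop

lemma integrable_of_continuous_sphere {d : ℕ} (hd : 1 ≤ d) {f : Sph d → ℝ} (hf : Continuous f) :
    Integrable f (uniformSphere d) := by
  have := isProbabilityMeasure_uniformSphere hd
  obtain ⟨C, hC⟩ := (isCompact_univ (X := Sph d)).exists_bound_of_continuousOn hf.continuousOn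
  exact Integrable.of_bound hf.aestronglyMeasurable C (ae_of_all _ fun x => hC x trivial)

lemma integral_exp_inner_le {d : ℕ} (hd : 1 ≤ d) {S : ℝ} {u : Vec d} (hu : ‖u‖ ≤ S * √d) :
    ∫ c : Sph d, Real.exp (inner ℝ u (c : Vec d)) ∂(uniformSphere d) ≤ Real.exp (S ^ 2 / 2) := by
  have h0 : (0 : ℝ) < d := by exact_mod_cast hd
  refine (integral_exp_inner_bounds hd u).2.trans (Real.exp_le_exp.2 ?_)
  have h1 : ‖u‖ ^ 2 ≤ (S * √d) ^ 2 := by gcongr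
  rw [mul_pow, Real.sq_sqrt h0.le] at h1
  rw [div_le_div_iff₀ (by positivity) two_pos]
  linarith

lemma one_le_integral_exp_inner {d : ℕ} (hd : 1 ≤ d) (u : Vec d) :
    1 ≤ ∫ c : Sph d, Real.exp (inner ℝ u (c : Vec d)) ∂(uniformSphere d) := by
  have h := le_hasSum (hasSum_moment_even hd u) 0 fun k _ =>
    le_trans (by positivity) (moment_even_bounds hd u k).1
  simpa [moment_zero hd] using h

lemma integral_expSum_le {V : Type*} [Fintype V] {d : ℕ} (hd : 1 ≤ d) {S : ℝ} {y : V → Vec d}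
    (hy : ∀ w, ‖y w‖ ≤ S * √d) :
    ∫ c : Sph d, expSum y c ∂(uniformSphere d) ≤ Fintype.card V * Real.exp (S ^ 2 / 2) := by
  unfold expSum
  rw [integral_finsetSum _ fun w _ => integrable_of_continuous_sphere hd (by fun_prop)]
  refine (Finset.sum_le_sum fun w _ => integral_exp_inner_le hd (hy w)).trans ?_
  simp

/-! ### The concentration value is of the order of the number of words -/

section Concentration

variable {V : Type*} [Fintype V] {d : ℕ} {S θ δ δ₀ η Z : ℝ} {y : V → Vec d}

lemma measurableSet_concentration (y : V → Vec d) (Z η : ℝ) :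
    MeasurableSet {c : Sph d | (1 - η) * Z ≤ expSum y c ∧ expSum y c ≤ (1 + η) * Z} := by
  have h : Measurable fun c : Sph d => expSum y c :=
    ((continuous_expSum y).comp continuous_subtype_val).measurable
  exact (measurableSet_le measurable_const h).inter (measurableSet_le h measurable_const)

/-- Markov's inequality: the partition function is at least `(1 - η) Z` with probability at least `1
- δ₀`, while its mean is at most `n exp (S² / 2)`. -/
lemma Concentrates.le_card_mul (hd : 1 ≤ d) (hy : ∀ w, ‖y w‖ ≤ S * √d)
    (h : Concentrates (expSum y) Z η δ) (hη : η ≤ θ) (hθ : θ < 1)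
    (hδ : δ ≤ δ₀) (hδ₀ : δ₀ < 1) :
    Z ≤ Fintype.card V * (Real.exp (S ^ 2 / 2) / ((1 - θ) * (1 - δ₀))) := by
  have := isProbabilityMeasure_uniformSphere hd
  obtain ⟨hZ, hc⟩ := h
  set G := {c : Sph d | (1 - η) * Z ≤ expSum y c ∧ expSum y c ≤ (1 + η) * Z}
  have hG : MeasurableSet G := measurableSet_concentration y Z η
  have hF := integrable_of_continuous_sphere hd
    ((continuous_expSum y).comp continuous_subtype_val)
  have h1 : ∫ c, G.indicator (fun _ => (1 - η) * Z) c ∂(uniformSphere d)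
      ≤ ∫ c : Sph d, expSum y c ∂(uniformSphere d) := by
    refine integral_mono ((integrable_const _).indicator hG) hF fun c => ?_
    by_cases hc : c ∈ G
    · simpa [hc] using hc.1
    · rw [Set.indicator_of_notMem hc]
      exact Finset.sum_nonneg fun _ _ => (Real.exp_pos _).le
  rw [integral_indicator_const _ hG, smul_eq_mul] at h1
  have h2 := h1.trans (integral_expSum_le hd hy)
  have h3 : (1 - δ₀) * ((1 - θ) * Z) ≤ (uniformSphere d).real G * ((1 - η) * Z) := by
    have : 0 < (1 - θ) * Z := mul_pos (by linarith) hZ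
    gcongr; linarith
  rw [← mul_div_assoc, le_div_iff₀ (mul_pos (by linarith) (by linarith))]
  linarith

/-- A small sum of the `exp ⟨y w, c⟩` forces a large sum of their reciprocals, whose mean is also at
most `n exp (S² / 2)`. -/
lemma Concentrates.card_mul_le (hd : 1 ≤ d) (hy : ∀ w, ‖y w‖ ≤ S * √d)
    (h : Concentrates (expSum y) Z η δ) (hη : η ≤ θ) (hθ : θ < 1)
    (hδ : δ ≤ δ₀) (hδ₀ : δ₀ < 1) :
    Fintype.card V * ((1 - δ₀) / (2 * Real.exp (S ^ 2 / 2))) ≤ Z := by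
  have := isProbabilityMeasure_uniformSphere hd
  obtain ⟨hZ, hc⟩ := h
  set G := {c : Sph d | (1 - η) * Z ≤ expSum y c ∧ expSum y c ≤ (1 + η) * Z}
  have hG : MeasurableSet G := measurableSet_concentration y Z η
  set n : ℝ := (Fintype.card V : ℝ) with hn
  set E := Real.exp (S ^ 2 / 2)
  -- Reciprocals enter through `z + t² / z ≥ 2t`. This `t` balances the bound `t² n E` on their
  -- weighted mean against `(1 - δ₀) t n`, so `Z < n t / 2` is contradictory.
  set t := (1 - δ₀) / E with ht
  have hE : 0 < E := Real.exp_pos _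
  have ht0 : 0 < t := div_pos (by linarith) hE
  have htE : t * E = 1 - δ₀ := by rw [ht]; field_simp
  have hF := integrable_of_continuous_sphere hd
    ((continuous_expSum fun w => -y w).comp continuous_subtype_val)
  have h1 : ∫ c, (G.indicator (fun _ => 2 * t * n - 2 * Z) c) ∂(uniformSphere d)
      ≤ ∫ c : Sph d, t ^ 2 * expSum (fun w => -y w) c ∂(uniformSphere d) := by
    refine integral_mono ((integrable_const _).indicator hG) (hF.const_mul _) fun c => ?_
    by_cases hc : c ∈ G
    · rw [Set.indicator_of_mem hc]
      have hle : expSum y c ≤ 2 * Z := hc.2.trans (by gcongr; linarith)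
      have hpt : ∀ w, 2 * t - Real.exp (inner ℝ (y w) (c : Vec d))
          ≤ t ^ 2 * Real.exp (inner ℝ (-y w) (c : Vec d)) := fun w => by
        rw [inner_neg_left, Real.exp_neg]
        set z := Real.exp (inner ℝ (y w) (c : Vec d))
        have hz : 0 < z := Real.exp_pos _
        have e1 : t ^ 2 * z⁻¹ - (2 * t - z) = (z - t) ^ 2 * z⁻¹ := by field_simp; ring
        have e2 : 0 ≤ (z - t) ^ 2 * z⁻¹ := by positivity
        linarith
      have hsum := Finset.sum_le_sum fun w (_ : w ∈ Finset.univ) => hpt w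
      rw [Finset.sum_sub_distrib, ← Finset.mul_sum, Finset.sum_const, Finset.card_univ,
        nsmul_eq_mul, ← hn] at hsum
      unfold expSum at hle ⊢
      rw [Finset.mul_sum]
      linarith
    · rw [Set.indicator_of_notMem hc]
      exact mul_nonneg (by positivity) (Finset.sum_nonneg fun _ _ => (Real.exp_pos _).le)
  rw [integral_indicator_const _ hG, integral_const_mul, smul_eq_mul] at h1
  have h2 : t ^ 2 * ∫ c : Sph d, expSum (fun w => -y w) c ∂(uniformSphere d) ≤ t ^ 2 * (n * E) := by
    gcongr
    exact integral_expSum_le hd fun w => by simpa using hy w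
  have hn0 : 0 ≤ n := by positivity
  by_contra! hlt
  have e1 : n * ((1 - δ₀) / (2 * E)) = n * t / 2 := by rw [ht]; field_simp
  rw [e1] at hlt
  have h3 : (1 - δ₀) * (t * n) ≤ (uniformSphere d).real G * (t * n) := by gcongr; linarith
  have h4 : 0 < (uniformSphere d).real G := by linarith
  have h5 : (uniformSphere d).real G * (t * n) < (uniformSphere d).real G * (2 * t * n - 2 * Z) := by
    gcongr; linarith
  have h6 : t ^ 2 * (n * E) = (1 - δ₀) * (t * n) := by rw [← htE]; ring
  linarith

end Concentration

/-- The probability of picking the word `w l` for every `l`, independently, with log-linear weights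
`⟨y l ·, c⟩`. -/
def wordsProb {V : Type*} [Fintype V] {d m : ℕ} (y : Fin m → V → Vec d) (w : Fin m → V)
    (c : Vec d) : ℝ :=
  ∏ l, (Real.exp (inner ℝ (y l (w l)) c) / expSum (y l) c)

lemma prod_exp_inner {V : Type*} {d m : ℕ} (y : Fin m → V → Vec d) (w : Fin m → V)
    (c : Vec d) :
    ∏ l, Real.exp (inner ℝ (y l (w l)) c) = Real.exp (inner ℝ (∑ l, y l (w l)) c) := by
  rw [sum_inner, Real.exp_sum]

/-! ### Products of log-linear weights and their reciprocals -/

section WordsProb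

variable {V : Type*} [Fintype V] {d m : ℕ} (y : Fin m → V → Vec d) (w : Fin m → V)

lemma wordsProb_pos (c : Vec d) : 0 < wordsProb y w c :=
  Finset.prod_pos fun l _ => by
    have : Nonempty V := ⟨w l⟩
    exact div_pos (Real.exp_pos _) (expSum_pos _ _)

lemma wordsProb_le_one (c : Vec d) : wordsProb y w c ≤ 1 := by
  refine Finset.prod_le_one (fun l _ => ?_) fun l _ => ?_
  · exact div_nonneg (Real.exp_pos _).le (Finset.sum_nonneg fun _ _ => (Real.exp_pos _).le)
  · have : Nonempty V := ⟨w l⟩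
    rw [div_le_one (expSum_pos _ _)]
    exact Finset.single_le_sum (f := fun w' => Real.exp (inner ℝ (y l w') c))
      (fun _ _ => (Real.exp_pos _).le) (Finset.mem_univ (w l))

lemma continuous_wordsProb : Continuous (wordsProb y w) := by
  refine continuous_finsetProd _ fun l _ => ?_
  have : Nonempty V := ⟨w l⟩
  exact Continuous.div (by fun_prop) (continuous_expSum _) fun c => (expSum_pos _ c).ne'

/-- Expanding the product of partition functions over all `m`-tuples of words keeps the reciprocal
within reach of the Laplace transform bound, with no concentration needed. -/
lemma inv_wordsProb (c : Vec d) :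
    (wordsProb y w c)⁻¹ = ∑ z : Fin m → V, Real.exp (inner ℝ (∑ l, (y l (z l) - y l (w l))) c) := by
  classical
  unfold wordsProb
  rw [← Finset.prod_inv_distrib]
  have h : ∀ l, (Real.exp (inner ℝ (y l (w l)) c) / expSum (y l) c)⁻¹
      = ∑ z, Real.exp (inner ℝ (y l z - y l (w l)) c) := fun l => by
    rw [inv_div, expSum, Finset.sum_div]
    simp only [inner_sub_left, Real.exp_sub]
  simp only [h]
  rw [Finset.prod_univ_sum, Fintype.piFinset_univ]
  simp only [sum_inner, Real.exp_sum]

variable {y}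

lemma norm_sum_le_mul_sqrt {S : ℝ} {x : Fin m → Vec d} (hx : ∀ l, ‖x l‖ ≤ S * √d) :
    ‖∑ l, x l‖ ≤ m * S * √d := by
  refine (norm_sum_le _ _).trans ((Finset.sum_le_sum fun l _ => hx l).trans ?_)
  simp [mul_assoc]

lemma integral_inv_wordsProb_le {S : ℝ} (hd : 1 ≤ d) (hy : ∀ l w, ‖y l w‖ ≤ S * √d) :
    ∫ c : Sph d, (wordsProb y w c)⁻¹ ∂(uniformSphere d)
      ≤ (Fintype.card V : ℝ) ^ m * Real.exp ((2 * m * S) ^ 2 / 2) := by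
  simp only [inv_wordsProb]
  have h := integral_expSum_le (V := Fin m → V) hd
    (y := fun z => ∑ l, (y l (z l) - y l (w l))) (S := 2 * m * S) fun z => by
      have := norm_sum_le_mul_sqrt (d := d) (S := 2 * S) (x := fun l => y l (z l) - y l (w l))
        fun l => (norm_sub_le _ _).trans (by linarith [hy l (z l), hy l (w l)])
      refine this.trans (le_of_eq (by ring))
  simpa [expSum] using h

end WordsProb

/-- Completing the square in `L`. With `L = log n` it shows that `exp (-c log² n)` beats every power
of `n`. -/
lemma exp_mul_log_sub_sq_le {c : ℝ} (hc : 0 < c) (q L : ℝ) :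
    Real.exp (q * L - c * L ^ 2) ≤ Real.exp (q ^ 2 / (4 * c)) := by
  refine Real.exp_le_exp.2 ?_
  rw [le_div_iff₀ (by positivity)]
  nlinarith [sq_nonneg (2 * c * L - q)]

lemma inv_le_inv_sqrt {n : ℝ} (hn : 1 ≤ n) : n⁻¹ ≤ 1 / √n := by
  rw [← one_div]
  have : √n ≤ n := Real.sqrt_le_self_iff.2 (by right; exact hn)
  have h0 : 0 < √n := Real.sqrt_pos.2 (by linarith)
  gcongr

/-- `n ^ m` times a quantity of order `exp (-c log² n)` is `O(1 / √n)`. -/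
lemma pow_mul_exp_neg_log_sq_le {c : ℝ} (hc : 0 < c) (m : ℕ) {n : ℝ} (hn : 1 ≤ n) :
    n ^ m * Real.exp (-(c * Real.log n ^ 2)) ≤ Real.exp ((m + 1) ^ 2 / (4 * c)) * (1 / √n) := by
  have h0 : 0 < n := by linarith
  have e1 : n ^ m = Real.exp (m * Real.log n) := by
    rw [Real.exp_nat_mul, Real.exp_log h0]
  have e2 : n⁻¹ = Real.exp (-Real.log n) := by rw [Real.exp_neg, Real.exp_log h0]
  calc n ^ m * Real.exp (-(c * Real.log n ^ 2))
      = Real.exp ((m + 1) * Real.log n - c * Real.log n ^ 2) * n⁻¹ := by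
        rw [e1, e2, ← Real.exp_add, ← Real.exp_add]; congr 1; ring
    _ ≤ Real.exp ((m + 1) ^ 2 / (4 * c)) * (1 / √n) := by
        exact mul_le_mul (exp_mul_log_sub_sq_le hc _ _) (inv_le_inv_sqrt hn) (by positivity)
          (by positivity)

/-- Rests on `1 - η ≥ exp (-η / (1 - η))` and `η ≤ θ < 1`; the exponential form lets the errors of
several partition functions add up. -/
lemma bounds_of_concentration {F Z η θ : ℝ} (hZ : 0 < Z) (hη0 : 0 ≤ η) (hη : η ≤ θ) (hθ : θ < 1)
    (h1 : (1 - η) * Z ≤ F) (h2 : F ≤ (1 + η) * Z) :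
    Z * Real.exp (-(η / (1 - θ))) ≤ F ∧ F ≤ Z * Real.exp (η / (1 - θ)) := by
  have hγ : η / (1 - η) ≤ η / (1 - θ) := by gcongr
  have hge : η ≤ η / (1 - θ) := by
    rw [le_div_iff₀ (by linarith)]; nlinarith
  constructor
  · have h3 : Real.exp (-(η / (1 - η))) ≤ 1 - η := by
      rw [Real.exp_neg, inv_le_comm₀ (Real.exp_pos _) (by linarith)]
      refine le_trans (le_of_eq ?_) (Real.add_one_le_exp _)
      have : 1 - η ≠ 0 := by linarith
      field_simp; ring
    have h4 : Real.exp (-(η / (1 - θ))) ≤ Real.exp (-(η / (1 - η))) := by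
      rw [Real.exp_le_exp]; linarith
    refine le_trans ?_ h1
    rw [mul_comm]
    gcongr
    linarith
  · refine h2.trans ?_
    rw [mul_comm]
    gcongr
    linarith [Real.add_one_le_exp (η / (1 - θ))]

lemma wordsProb_bounds {V : Type*} [Fintype V] {d m : ℕ} {y : Fin m → V → Vec d} {w : Fin m → V}
    {Z η : Fin m → ℝ} {θ : ℝ} (hZ : ∀ l, 0 < Z l) (hη0 : ∀ l, 0 ≤ η l) (hη : ∀ l, η l ≤ θ)
    (hθ : θ < 1) {c : Vec d}
    (hc : ∀ l, (1 - η l) * Z l ≤ expSum (y l) c ∧ expSum (y l) c ≤ (1 + η l) * Z l) :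
    Real.exp (inner ℝ (∑ l, y l (w l)) c - ∑ l, η l / (1 - θ)) / ∏ l, Z l ≤ wordsProb y w c ∧
      wordsProb y w c ≤ Real.exp (inner ℝ (∑ l, y l (w l)) c + ∑ l, η l / (1 - θ)) / ∏ l, Z l := by
  have hb := fun l => bounds_of_concentration (hZ l) (hη0 l) (hη l) hθ (hc l).1 (hc l).2
  have hF : ∀ l, 0 < expSum (y l) c := fun l => lt_of_lt_of_le (by have := hZ l; positivity) (hb l).1
  constructor
  · rw [sub_eq_add_neg, Real.exp_add, ← prod_exp_inner, ← Finset.sum_neg_distrib, Real.exp_sum,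
      ← Finset.prod_mul_distrib, ← Finset.prod_div_distrib]
    refine Finset.prod_le_prod (fun l _ => by have := hZ l; positivity) fun l _ => ?_
    rw [mul_div_assoc, div_eq_mul_inv (Real.exp (inner ℝ (y l (w l)) c))]
    gcongr
    rw [div_le_iff₀ (hZ l), ← div_eq_inv_mul, le_div_iff₀ (hF l)]
    calc _ ≤ Real.exp (-(η l / (1 - θ))) * (Z l * Real.exp (η l / (1 - θ))) := by
          gcongr; exact (hb l).2
      _ = Z l := by rw [Real.exp_neg]; field_simp
  · rw [Real.exp_add, ← prod_exp_inner, Real.exp_sum,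
      ← Finset.prod_mul_distrib, ← Finset.prod_div_distrib]
    refine Finset.prod_le_prod (fun l _ => div_nonneg (Real.exp_pos _).le (hF l).le) fun l _ => ?_
    rw [mul_div_assoc, div_eq_mul_inv (Real.exp (inner ℝ (y l (w l)) c))]
    gcongr
    rw [le_div_iff₀ (hZ l), ← div_eq_inv_mul, div_le_iff₀ (hF l)]
    calc Z l = Real.exp (η l / (1 - θ)) * (Z l * Real.exp (-(η l / (1 - θ)))) := by
          rw [Real.exp_neg]; field_simp
      _ ≤ _ := by gcongr; exact (hb l).1

/-- For `c` uniform on the sphere, the probability of picking given words with log-linear weights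
whose partition functions concentrate. -/
theorem log_integral_wordsProb (m : ℕ) {S θ c₁ : ℝ} (hθ : θ < 1) (hc₁ : 0 < c₁) :
    ∃ C : ℝ, 0 < C ∧ ∀ (d : ℕ) (_ : 1 ≤ d) (V : Type*) [Fintype V] (n : ℕ)
      (_ : Fintype.card V = n) (_ : 2 ≤ n) (y : Fin m → V → Vec d) (w : Fin m → V)
      (_ : ∀ l w, ‖y l w‖ ≤ S * √d) (Z η : Fin m → ℝ) (_ : ∀ l, 0 ≤ η l) (_ : ∀ l, η l ≤ θ)
      (_ : ∀ l, Concentrates (expSum (y l)) (Z l) (η l) (Real.exp (-(c₁ * Real.log n ^ 2)))),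
      0 < ∫ c : Sph d, wordsProb y w c ∂(uniformSphere d) ∧
      |Real.log (∫ c : Sph d, wordsProb y w c ∂(uniformSphere d))
        - (‖∑ l, y l (w l)‖ ^ 2 / (2 * d) - ∑ l, Real.log (Z l))|
        ≤ C * (∑ l, η l + 1 / √(n : ℝ) + 1 / d) := by
  -- The failure probability at `n = 2`, which bounds it for all `n ≥ 2` and stays away from `1`.
  set δ₀ := Real.exp (-(c₁ * Real.log 2 ^ 2)) with hδ₀def
  have hlog2 : 0 < Real.log 2 := Real.log_pos (by norm_num)
  have hδ₀ : δ₀ < 1 := by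
    rw [hδ₀def, Real.exp_lt_one_iff]
    have : 0 < c₁ * Real.log 2 ^ 2 := by positivity
    linarith
  set κ₁ := (1 - δ₀) / (2 * Real.exp (S ^ 2 / 2))
  set κ₂ := Real.exp (S ^ 2 / 2) / ((1 - θ) * (1 - δ₀))
  have hκ₁ : 0 < κ₁ := div_pos (by linarith) (by positivity)
  have hκ₂ : 0 < κ₂ := div_pos (by positivity) (mul_pos (by linarith) (by linarith))
  -- One constant for two purposes: it bounds `E exp (2 ⟨u, c⟩)`, and `nᵐ B` bounds the mean of the
  -- reciprocal. Then `e` compares `nᵐ B` with `∏ Z ≥ (n κ₁)ᵐ`, and `s₀` bounds `‖u‖² / (2d)` for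
  -- every `d`.
  set B := Real.exp ((2 * m * S) ^ 2 / 2)
  set e := |Real.log (B / κ₁ ^ m)|
  set s₀ := (m * S) ^ 2 / 2 with hs₀
  set γ := 1 / (1 - θ)
  have hγ : 0 < γ := div_pos one_pos (by linarith)
  set A₁ := (m + 1) * κ₂ ^ m * Real.exp ((m + 1) ^ 2 / (4 * c₁))
  set A₂ := (B + 1) * (1 + e + s₀) * (√(m + 1) * Real.exp ((0 + 1) ^ 2 / (4 * (c₁ / 2))))
  have hA₁ : 0 < A₁ := by positivity
  have hA₂ : 0 < A₂ := by positivity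
  refine ⟨γ + s₀ ^ 2 + A₁ + A₂, by positivity, ?_⟩
  intro d hd V _ n hn hn2 y w hy Z η hη0 hη hc
  have hprob := isProbabilityMeasure_uniformSphere hd
  have h0 : (0 : ℝ) < d := by exact_mod_cast hd
  have hn1 : (1 : ℝ) ≤ n := by exact_mod_cast (by omega : 1 ≤ n)
  set δ := Real.exp (-(c₁ * Real.log n ^ 2)) with hδdef
  have hδδ₀ : δ ≤ δ₀ := by
    rw [hδdef, hδ₀def, Real.exp_le_exp]
    have : Real.log 2 ≤ Real.log n := Real.log_le_log (by norm_num) (by exact_mod_cast hn2)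
    gcongr
  set σ := uniformSphere d
  set q : Sph d → ℝ := fun c => wordsProb y w c
  set u := ∑ l, y l (w l)
  set X : Sph d → ℝ := fun c => inner ℝ u (c : Vec d)
  set D := ∏ l, Z l
  have hZ : ∀ l, 0 < Z l := fun l => (hc l).1
  have hD : 0 < D := Finset.prod_pos fun l _ => hZ l
  set s := ‖u‖ ^ 2 / (2 * d) with hs
  have hs0 : 0 ≤ s := by positivity
  have hu : ‖u‖ ≤ m * S * √d := norm_sum_le_mul_sqrt fun l => hy l (w l)
  have hss₀ : s ≤ s₀ := by
    have h1 : ‖u‖ ^ 2 ≤ (m * S * √d) ^ 2 := by gcongr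
    rw [mul_pow, Real.sq_sqrt h0.le] at h1
    rw [hs, hs₀, div_le_div_iff₀ (by positivity) two_pos]
    linarith
  set G : Set (Sph d) := ⋂ l, {c : Sph d | (1 - η l) * Z l ≤ expSum (y l) c ∧
    expSum (y l) c ≤ (1 + η l) * Z l}
  have hG : MeasurableSet G := MeasurableSet.iInter fun l => measurableSet_concentration _ _ _
  -- A union bound, with `m + 1` in place of `m` so that the bound is positive also when `m = 0`.
  have hGδ : σ.real Gᶜ ≤ (m + 1) * δ := by
    rw [Set.compl_iInter]
    refine (measureReal_iUnion_fintype_le _).trans ?_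
    calc _ ≤ ∑ l : Fin m, δ := Finset.sum_le_sum fun l _ => by
          rw [probReal_compl_eq_one_sub (measurableSet_concentration _ _ _)]
          linarith [(hc l).2]
      _ = m * δ := by simp
      _ ≤ _ := by
          have : 0 < δ := Real.exp_pos _
          linarith
  set a := ∑ l, η l / (1 - θ) with ha
  have ha0 : 0 ≤ a := Finset.sum_nonneg fun l _ => div_nonneg (hη0 l) (by linarith)
  have haγ : a = γ * ∑ l, η l := by
    rw [ha, ← Finset.sum_div]; ring
  have hqpos : ∀ c, 0 < q c := fun c => wordsProb_pos y w c
  have hqc : Continuous q := (continuous_wordsProb y w).comp continuous_subtype_val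
  have hqi : Integrable q σ := integrable_of_continuous_sphere hd hqc
  have hQi : Integrable (fun c => (q c)⁻¹) σ :=
    integrable_of_continuous_sphere hd (hqc.inv₀ fun c => (hqpos c).ne')
  have hXi : Integrable (fun c => Real.exp (X c)) σ :=
    integrable_of_continuous_sphere hd (by fun_prop)
  have hXi2 : Integrable (fun c => Real.exp (2 * X c)) σ :=
    integrable_of_continuous_sphere hd (by fun_prop)
  have hbd : ∀ c ∈ G, Real.exp (X c - a) / D ≤ q c ∧ q c ≤ Real.exp (X c + a) / D := fun c hcG =>
    wordsProb_bounds hZ hη0 hη hθ fun l => by simpa using Set.mem_iInter.1 hcG l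
  have hB : ∫ c, Real.exp (2 * X c) ∂σ ≤ B := by
    have := integral_exp_inner_le hd (u := (2 : ℝ) • u) (S := 2 * m * S) (by
      rw [norm_smul, Real.norm_eq_abs, abs_two]
      calc 2 * ‖u‖ ≤ 2 * (m * S * √d) := by gcongr
        _ = _ := by ring)
    simpa [inner_smul_left] using this
  have hQ := integral_inv_wordsProb_le w hd hy
  rw [hn] at hQ
  have hnpos : (0 : ℝ) < n := by linarith
  have hDlow : (n * κ₁) ^ m ≤ D := by
    calc (n * κ₁) ^ m = ∏ _l : Fin m, (n * κ₁) := by simp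
      _ ≤ D := Finset.prod_le_prod (fun _ _ => by positivity) fun l _ => by
          have := (hc l).card_mul_le hd (hy l) (hη l) hθ hδδ₀ hδ₀
          rwa [hn] at this
  have hDup : D ≤ (n * κ₂) ^ m := by
    calc D ≤ ∏ _l : Fin m, (n * κ₂) := Finset.prod_le_prod (fun l _ => (hZ l).le) fun l _ => by
          have := (hc l).le_card_mul hd (hy l) (hη l) hθ hδδ₀ hδ₀
          rwa [hn] at this
      _ = _ := by simp
  have hQD : (n : ℝ) ^ m * B ≤ Real.exp e * D := by
    have h1 : B / κ₁ ^ m ≤ Real.exp e := by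
      rw [← Real.exp_log (show 0 < B / κ₁ ^ m by positivity)]
      exact Real.exp_le_exp.2 (le_abs_self _)
    calc (n : ℝ) ^ m * B = B / κ₁ ^ m * (n * κ₁) ^ m := by rw [mul_pow]; field_simp
      _ ≤ _ := by gcongr
  have hlow := le_log_integral σ (τ := s ^ 2 / d) hqpos hqi hG (δ := (m + 1) * δ) (by positivity)
    hGδ hD ha0 hs0 (by positivity) hXi hXi2 (integral_exp_inner_bounds hd u).1
    (one_le_integral_exp_inner hd u) hB hQi hQ (by positivity) hQD (abs_nonneg _)
    fun c hc => (hbd c hc).1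
  have hpos : 0 < ∫ c, q c ∂σ := lt_of_lt_of_le (by positivity)
    (inv_le_integral_of_integral_inv_le σ hqpos hqi hQi hQ (by positivity))
  have hup := log_integral_le σ hqi (wordsProb_le_one y w ·) hpos hG hGδ hD ha0 hs0 hXi
    (integral_exp_inner_bounds hd u).2 fun c hc => (hbd c hc).2
  have hlogD : Real.log D = ∑ l, Real.log (Z l) := Real.log_prod fun l _ => (hZ l).ne'
  -- The only source of the `1 / d` error.
  have hτ : s ^ 2 / d ≤ s₀ ^ 2 * (1 / d) := by
    rw [← div_eq_mul_one_div]; gcongr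
  have hA₁' : (m + 1) * δ * D ≤ A₁ * (1 / √n) := by
    calc (m + 1) * δ * D ≤ (m + 1) * δ * (n * κ₂) ^ m := by gcongr
      _ = (m + 1) * κ₂ ^ m * (n ^ m * δ) := by rw [mul_pow]; ring
      _ ≤ (m + 1) * κ₂ ^ m * (Real.exp ((m + 1) ^ 2 / (4 * c₁)) * (1 / √n)) := by
          exact mul_le_mul_of_nonneg_left (pow_mul_exp_neg_log_sq_le hc₁ m hn1) (by positivity)
      _ = _ := by ring
  have hA₂' : (B + 1) * (1 + e + s) * √((m + 1) * δ) ≤ A₂ * (1 / √n) := by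
    have h1 : √δ ≤ Real.exp ((0 + 1) ^ 2 / (4 * (c₁ / 2))) * (1 / √n) := by
      have := pow_mul_exp_neg_log_sq_le (half_pos hc₁) 0 hn1
      rw [pow_zero, one_mul, Nat.cast_zero] at this
      refine le_trans (le_of_eq ?_) this
      rw [hδdef, Real.sqrt_eq_iff_mul_self_eq (Real.exp_pos _).le (Real.exp_pos _).le,
        ← Real.exp_add]
      congr 1; ring
    rw [Real.sqrt_mul (by positivity)]
    calc _ ≤ (B + 1) * (1 + e + s₀) * (√(m + 1) *
          (Real.exp ((0 + 1) ^ 2 / (4 * (c₁ / 2))) * (1 / √n))) := by gcongr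
      _ = _ := by ring
  refine ⟨hpos, ?_⟩
  have hsum : 0 ≤ ∑ l, η l := Finset.sum_nonneg fun l _ => hη0 l
  have hN : 0 ≤ 1 / √(n : ℝ) := by positivity
  have hd' : 0 ≤ 1 / (d : ℝ) := by positivity
  have hfin : a + s ^ 2 / d + A₁ * (1 / √n) + A₂ * (1 / √n)
      ≤ (γ + s₀ ^ 2 + A₁ + A₂) * (∑ l, η l + 1 / √(n : ℝ) + 1 / d) := by
    have e1 : 0 ≤ γ * (1 / √(n : ℝ) + 1 / d) := by positivity
    have e2 : 0 ≤ s₀ ^ 2 * (∑ l, η l + 1 / √(n : ℝ)) := by positivity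
    have e3 : 0 ≤ (A₁ + A₂) * (∑ l, η l + 1 / d) := by positivity
    rw [haγ]
    linarith
  have hp1 : 0 ≤ A₁ * (1 / √(n : ℝ)) := by positivity
  have hp2 : 0 ≤ A₂ * (1 / √(n : ℝ)) := by positivity
  have hp3 : 0 ≤ s ^ 2 / (d : ℝ) := by positivity
  rw [← hlogD, abs_le]
  constructor <;> linarith

/-- The probability of `w` under the log-linear weights `⟨y ·, c⟩`. -/
def softmax {V : Type*} [Fintype V] {d : ℕ} (y : V → Vec d) (w : V) (c : Vec d) : ℝ :=
  Real.exp (inner ℝ (y w) c) / expSum y c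

section Softmax

variable {V : Type*} [Fintype V] {d : ℕ} (y : V → Vec d) (w : V)

lemma softmax_pos (c : Vec d) : 0 < softmax y w c :=
  have : Nonempty V := ⟨w⟩
  div_pos (Real.exp_pos _) (expSum_pos _ _)

lemma continuous_softmax : Continuous (softmax y w) := by
  have : Nonempty V := ⟨w⟩
  exact Continuous.div (by fun_prop) (continuous_expSum _) fun c => (expSum_pos _ c).ne'

lemma sum_softmax [Nonempty V] (c : Vec d) : ∑ w, softmax y w c = 1 := by
  simp only [softmax]
  rw [← Finset.sum_div]
  exact div_self (expSum_pos y c).ne'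

variable {y}

/-- Each exponent moves by at most `S √d · ρ / √d = S ρ`; numerator and partition function each
contribute one such factor. -/
lemma softmax_le_exp_mul {S ρ : ℝ} {c c' : Vec d} (hρ : ‖c - c'‖ ≤ ρ / √d) (hd : 1 ≤ d)
    (hS : 0 ≤ S) (hy : ∀ w, ‖y w‖ ≤ S * √d) :
    softmax y w c ≤ Real.exp (2 * S * ρ) * softmax y w c' := by
  have : Nonempty V := ⟨w⟩
  have h0 : (0 : ℝ) < √d := Real.sqrt_pos.2 (by exact_mod_cast hd)
  have hin : ∀ w, |inner ℝ (y w) c - inner ℝ (y w) c'| ≤ S * ρ := fun w => by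
    rw [← inner_sub_right]
    calc _ ≤ ‖y w‖ * ‖c - c'‖ := abs_real_inner_le_norm _ _
      _ ≤ (S * √d) * (ρ / √d) := by gcongr; exact hy w
      _ = S * ρ := by field_simp
  have hsum : expSum y c' ≤ Real.exp (S * ρ) * expSum y c := by
    unfold expSum
    rw [Finset.mul_sum]
    refine Finset.sum_le_sum fun w _ => ?_
    rw [← Real.exp_add, Real.exp_le_exp]
    linarith [(abs_le.1 (hin w)).1]
  unfold softmax
  rw [← mul_div_assoc, div_le_div_iff₀ (expSum_pos y c) (expSum_pos y c')]
  calc _ ≤ Real.exp (S * ρ + inner ℝ (y w) c') * (Real.exp (S * ρ) * expSum y c) := by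
        have := (expSum_pos y c').le
        gcongr
        linarith [(abs_le.1 (hin w)).2]
    _ = _ := by
        rw [Real.exp_add, show 2 * S * ρ = S * ρ + S * ρ by ring, Real.exp_add]; ring

end Softmax

/-! ### The model -/

/-- The vectors `v_b + T(v_a, v_b, ·)` that govern the second word of a pair with root `a`. -/
def pairVec {V : Type*} {d : ℕ} (v : V → Vec d) (T : Tensor d) (a b : V) : Vec d :=
  v b + T.app2 (v a) (v b)

lemma Tensor.app3_eq_inner {d : ℕ} (T : Tensor d) (x y z : Vec d) :
    T.app3 x y z = inner ℝ (T.app2 x y) z := by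
  simp only [Tensor.app3, Tensor.app2, PiLp.inner_apply, RCLike.inner_apply, conj_trivial,
    Finset.mul_sum]
  rw [Finset.sum_congr rfl fun i _ => Finset.sum_comm, Finset.sum_comm]
  refine Finset.sum_congr rfl fun k _ => Finset.sum_congr rfl fun i _ =>
    Finset.sum_congr rfl fun j _ => by ring

lemma inner_add_app3 {V : Type*} {d : ℕ} (v : V → Vec d) (T : Tensor d) (a b : V) (c : Vec d) :
    inner ℝ c (v b) + T.app3 (v a) (v b) c = inner ℝ (pairVec v T a b) c := by
  rw [pairVec, inner_add_left, Tensor.app3_eq_inner, real_inner_comm]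

/-! ### Stationarity and small steps of the discourse walk -/

section Walk

variable {d : ℕ} {Ω : Type*} [MeasurableSpace Ω] {P : Measure Ω} {c : ℕ → Ω → Sph d} {εw : ℝ}

lemma IsDiscourseWalk.map_eq (h : IsDiscourseWalk P c εw) (t : ℕ) :
    P.map (c t) = uniformSphere d := by
  induction t with
  | zero => exact h.initial
  | succ t ih =>
    obtain ⟨κ, _, hinv, hκ⟩ := h.markov
    ext B hB
    have := hκ t Set.univ B MeasurableSet.univ hB
    simp only [Set.mem_univ, Set.ofPred_true, Set.univ_inter, Measure.restrict_univ] at this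
    rw [Measure.map_apply (h.measurable _) hB]
    refine Eq.trans this ?_
    rw [← lintegral_map (f := fun x => κ x B) (κ.measurable_coe hB) (h.measurable t), ih,
      ← Measure.bind_apply hB κ.aemeasurable, hinv.def]

/-- Comparing an expectation over two consecutive steps of the walk with an expectation over the
sphere. -/
lemma IsDiscourseWalk.logApprox [IsProbabilityMeasure P] (h : IsDiscourseWalk P c εw)
    (t : ℕ) {f g : Vec d → ℝ} (hf : Continuous f) (hg : Continuous g)
    (hg0 : ∀ c, 0 ≤ g c) {β x η : ℝ}
    (hfβ : ∀ c c', ‖c - c'‖ ≤ εw / √d → f c ≤ Real.exp β * f c')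
    (hpos : 0 < ∫ c : Sph d, f c * g c ∂(uniformSphere d))
    (hx : |Real.log (∫ c : Sph d, f c * g c ∂(uniformSphere d)) - x| ≤ η) :
    LogApprox (∫ ω, f (c t ω) * g (c (t + 1) ω) ∂P) x (β + η) := by
  have hfg : Continuous fun c : Sph d => f c * g c := by fun_prop
  have hmc := fun t => measurable_subtype_coe.comp (h.measurable t)
  -- Only `f` is transported, from time `t` to `t + 1`; `g` stays in place, so no regularity of its
  -- logarithm is needed.
  have hmap : ∫ ω, f (c (t + 1) ω) * g (c (t + 1) ω) ∂P
      = ∫ c : Sph d, f c * g c ∂(uniformSphere d) := by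
    rw [← h.map_eq (t + 1), integral_map (h.measurable _).aemeasurable
      hfg.aestronglyMeasurable]
  have hbdd : ∀ {k : Vec d → ℝ}, Continuous k → ∃ C, ∀ c : Sph d, ‖k c‖ ≤ C := fun {k} hk => by
    obtain ⟨C, hC⟩ := (isCompact_univ (X := Sph d)).exists_bound_of_continuousOn
      (hk.comp continuous_subtype_val).continuousOn
    exact ⟨C, fun c => hC c trivial⟩
  obtain ⟨Cf, hCf⟩ := hbdd hf
  obtain ⟨Cg, hCg⟩ := hbdd hg
  have hint : ∀ i j, Integrable (fun ω => f (c i ω) * g (c j ω)) P := fun i j => by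
    refine Integrable.of_bound ((hf.measurable.comp (hmc i)).mul
      (hg.measurable.comp (hmc j))).aestronglyMeasurable (Cf * Cg) (ae_of_all _ fun ω => ?_)
    rw [norm_mul]
    exact mul_le_mul (hCf _) (hCg _) (norm_nonneg _) ((norm_nonneg _).trans (hCf (c i ω)))
  set I := ∫ c : Sph d, f c * g c ∂(uniformSphere d)
  set J := ∫ ω, f (c t ω) * g (c (t + 1) ω) ∂P
  have hup : J ≤ Real.exp β * I := by
    rw [← hmap, ← integral_const_mul]
    refine integral_mono_ae (hint _ _) ((hint _ _).const_mul _) ?_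
    filter_upwards [h.step_le t] with ω hω
    show _ ≤ Real.exp β * (_ * _)
    rw [← mul_assoc]
    exact mul_le_mul_of_nonneg_right (hfβ _ _ hω) (hg0 _)
  have hlo : I ≤ Real.exp β * J := by
    rw [← hmap, ← integral_const_mul]
    refine integral_mono_ae (hint _ _) ((hint _ _).const_mul _) ?_
    filter_upwards [h.step_le t] with ω hω
    show _ ≤ Real.exp β * (_ * _)
    rw [← mul_assoc]
    rw [norm_sub_rev] at hω
    exact mul_le_mul_of_nonneg_right (hfβ _ _ hω) (hg0 _)
  have hJ : 0 < J := by
    by_contra! hJ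
    have : Real.exp β * J ≤ 0 := mul_nonpos_of_nonneg_of_nonpos (Real.exp_pos _).le hJ
    linarith
  refine ⟨hJ, ?_⟩
  have h1 := Real.log_le_log hJ hup
  have h2 := Real.log_le_log hpos hlo
  rw [Real.log_mul (by positivity) (by positivity), Real.log_exp] at h1 h2
  rw [abs_le] at hx ⊢
  constructor <;> linarith [hx.1, hx.2]

end Walk

lemma nonempty_of_emissions {V Ω : Type*} [MeasurableSpace Ω] (P : Measure Ω) [IsProbabilityMeasure P]
    (o : ℕ → Ω → Emission V) :
    Nonempty V := by
  obtain ⟨ω⟩ := P.nonempty_of_neZero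
  rcases o 0 ω with w | ⟨a, b⟩
  exacts [⟨w⟩, ⟨a⟩]

/-! ### From emissions to expectations over discourse vectors -/

section Model

variable {V : Type*} [Fintype V] {d : ℕ} (v : V → Vec d) (T : Tensor d)

/-- Puts `Z_{c,a}` in the same form as `Z_c`, so that one theorem about the sphere covers both. -/
lemma partitionAt_eq_expSum (a : V) : partitionAt v T a = expSum (pairVec v T a) := by
  ext c
  simp only [partitionAt, expSum, inner_add_app3]

lemma emissionProb_inl (p : ℝ) (c : Vec d) (w : V) :
    emissionProb v T p c (Sum.inl w) = (1 - p) * softmax v w c := by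
  simp only [emissionProb, softmax]
  rw [real_inner_comm]; rfl

lemma emissionProb_inr (p : ℝ) (c : Vec d) (a b : V) :
    emissionProb v T p c (Sum.inr (a, b)) = p * softmax v a c * softmax (pairVec v T a) b c := by
  simp only [emissionProb, softmax, inner_add_app3, partitionAt_eq_expSum]
  rw [real_inner_comm]; rfl

lemma emissionProb_nonneg {p : ℝ} (hp : 0 < p) (hp1 : p < 1) (c : Vec d) (z : Emission V) :
    0 ≤ emissionProb v T p c z := by
  rcases z with w | ⟨a, b⟩
  · rw [emissionProb_inl]
    exact mul_nonneg (by linarith) (softmax_pos _ _ _).le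
  · rw [emissionProb_inr]
    have := softmax_pos v a c
    have := softmax_pos (pairVec v T a) b c
    positivity

lemma continuous_emissionProb (p : ℝ) (z : Emission V) :
    Continuous fun c => emissionProb v T p c z := by
  rcases z with w | ⟨a, b⟩
  · simp only [emissionProb_inl]
    exact continuous_const.mul (continuous_softmax _ _)
  · simp only [emissionProb_inr]
    exact (continuous_const.mul (continuous_softmax _ _)).mul (continuous_softmax _ _)

lemma sum_emissionProb [Nonempty V] (p : ℝ) (c : Vec d) :
    ∑ z : Emission V, emissionProb v T p c z = 1 := by
  rw [Fintype.sum_sum_type, Fintype.sum_prod_type]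
  simp only [emissionProb_inl, emissionProb_inr, ← Finset.mul_sum, sum_softmax, mul_one]
  ring

variable {v T} {Ω : Type*} [MeasurableSpace Ω] {P : Measure Ω}
  {c : ℕ → Ω → Sph d} {o : ℕ → Ω → Emission V} {p εw : ℝ}

open Classical in
-- The event is the disjoint union over the sequences in the product of the `B i`; the sum of
-- products factors into a product of sums.
lemma IsModel.measure_emissions (h : IsModel v T p εw P c o) (hp : 0 < p) (hp1 : p < 1) (N : ℕ)
    (B : Fin N → Finset (Emission V)) :
    P {ω | ∀ i : Fin N, o i ω ∈ B i}
      = ∫⁻ ω, ENNReal.ofReal (∏ i : Fin N, ∑ z ∈ B i, emissionProb v T p (c i ω) z) ∂P := by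
  have hU : {ω | ∀ i : Fin N, o i ω ∈ B i}
      = ⋃ x ∈ Fintype.piFinset B, {ω | ∀ i : Fin N, o i ω = x i} := by
    ext ω
    simp only [Set.mem_ofPred_eq, Set.mem_iUnion, Fintype.mem_piFinset, exists_prop]
    constructor
    · exact fun hω => ⟨fun i => o i ω, hω, fun _ => rfl⟩
    · rintro ⟨x, hx, hω⟩ i
      rw [hω i]; exact hx i
  have hmeas : ∀ x : Fin N → Emission V, MeasurableSet {ω | ∀ i : Fin N, o i ω = x i} := fun x => by
    rw [Set.ofPred_forall]
    exact MeasurableSet.iInter fun i => h.measurable i (x i)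
  have hem : ∀ x : Fin N → Emission V, P {ω | ∀ i : Fin N, o i ω = x i}
      = ∫⁻ ω, ENNReal.ofReal (∏ i : Fin N, emissionProb v T p (c i ω) (x i)) ∂P := fun x => by
    simpa using h.emission N x Set.univ MeasurableSet.univ
  rw [hU, measure_biUnion_finset _ fun x _ => hmeas x]
  · simp only [hem]
    rw [← lintegral_finsetSum]
    · refine lintegral_congr fun ω => ?_
      rw [Finset.prod_univ_sum, ENNReal.ofReal_sum_of_nonneg]
      exact fun x _ => Finset.prod_nonneg fun i _ => emissionProb_nonneg v T hp hp1 _ _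
    · intro x _
      refine ENNReal.measurable_ofReal.comp (Finset.measurable_prod _ fun i _ => ?_)
      exact ((continuous_emissionProb v T p (x i)).measurable.comp measurable_subtype_coe).comp
        (h.walk.measurable i)
  · intro x _ x' _ hne
    refine Set.disjoint_left.2 fun ω hω hω' => hne ?_
    ext1 i
    rw [← hω i, ← hω' i]

open Classical in
-- Marginalization: the emissions before time `t` are left free, and their probabilities sum to `1`.
lemma IsModel.measure_consecutive [IsProbabilityMeasure P] (h : IsModel v T p εw P c o) (hp : 0 < p) (hp1 : p < 1) (t : ℕ)
    (B B' : Finset (Emission V)) :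
    P {ω | o t ω ∈ B ∧ o (t + 1) ω ∈ B'}
      = ∫⁻ ω, ENNReal.ofReal ((∑ z ∈ B, emissionProb v T p (c t ω) z)
          * ∑ z ∈ B', emissionProb v T p (c (t + 1) ω) z) ∂P := by
  have hne := nonempty_of_emissions P o
  have hm := h.measure_emissions hp hp1 (t + 2)
    (fun i => if (i : ℕ) = t then B else if (i : ℕ) = t + 1 then B' else Finset.univ)
  convert! hm using 2
  · ext ω
    simp only [Set.mem_ofPred_eq]
    constructor
    · rintro ⟨h1, h2⟩ i
      split_ifs with hi hi'
      · rwa [hi]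
      · rwa [hi']
      · exact Finset.mem_univ _
    · intro hi
      have h1 := hi ⟨t, by omega⟩
      have h2 := hi ⟨t + 1, by omega⟩
      simp only [if_true] at h1
      rw [if_neg (by simp), if_pos rfl] at h2
      exact ⟨h1, h2⟩
  · ext ω
    rw [Fin.prod_univ_castSucc, Fin.prod_univ_castSucc]
    have h1 : ∀ i : Fin t, (i : ℕ) ≠ t := fun i => i.2.ne
    have h2 : ∀ i : Fin t, (i : ℕ) ≠ t + 1 := fun i => by have := i.2; omega
    simp only [Fin.val_castSucc, Fin.val_last, h1, h2, if_true, if_false, sum_emissionProb,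
      Finset.prod_const_one, one_mul, Nat.succ_ne_self]

open Classical in
/-- Conditionally on a single word followed by a pair, the probability of an event that depends on
the two emissions through `A` and `A'`. -/
lemma IsModel.cond_real [IsProbabilityMeasure P] (h : IsModel v T p εw P c o) (hp : 0 < p) (hp1 : p < 1) (t : ℕ)
    (A A' : Emission V → Prop) {E : Set Ω}
    (hE : ∀ ω, ω ∈ singleThenPair o t → (ω ∈ E ↔ A (o t ω) ∧ A' (o (t + 1) ω)))
    {f g : Vec d → ℝ} (hf0 : ∀ c, 0 ≤ f c) (hf : Continuous f) (hg : Continuous g)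
    (hAf : ∀ c, (∑ w, if A (Sum.inl w) then softmax v w c else 0) = f c)
    (hAg : ∀ c, (∑ a, ∑ b, if A' (Sum.inr (a, b)) then
      softmax v a c * softmax (pairVec v T a) b c else 0) = g c) :
    (P[|singleThenPair o t]).real E = ∫ ω, f (c t ω) * g (c (t + 1) ω) ∂P := by
  have hne := nonempty_of_emissions P o
  have hS : singleThenPair o t = {ω | o t ω ∈ Finset.univ.filter (fun z : Emission V => z.isLeft)
      ∧ o (t + 1) ω ∈ Finset.univ.filter (fun z : Emission V => z.isRight)} := by
    ext ω; simp [singleThenPair]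
  have hSE : singleThenPair o t ∩ E
      = {ω | o t ω ∈ Finset.univ.filter (fun z : Emission V => z.isLeft ∧ A z)
      ∧ o (t + 1) ω ∈ Finset.univ.filter (fun z : Emission V => z.isRight ∧ A' z)} := by
    ext ω
    simp only [Set.mem_inter_iff, Set.mem_ofPred_eq, Finset.mem_filter, Finset.mem_univ, true_and]
    constructor
    · rintro ⟨h1, h2⟩
      have h3 := (hE ω h1).1 h2
      exact ⟨⟨h1.1, h3.1⟩, ⟨h1.2, h3.2⟩⟩
    · rintro ⟨⟨h1, h2⟩, ⟨h3, h4⟩⟩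
      exact ⟨⟨h1, h3⟩, (hE ω ⟨h1, h3⟩).2 ⟨h2, h4⟩⟩
  have hSm : MeasurableSet (singleThenPair o t) := by
    have : singleThenPair o t = (⋃ w : V, o t ⁻¹' {Sum.inl w}) ∩
        ⋃ ab : V × V, o (t + 1) ⁻¹' {Sum.inr ab} := by
      ext ω
      simp [singleThenPair, Sum.isLeft_iff, Sum.isRight_iff]
    rw [this]
    exact (MeasurableSet.iUnion fun _ => h.measurable _ _).inter
      (MeasurableSet.iUnion fun _ => h.measurable _ _)
  -- The kind of emission does not depend on the discourse vector, so conditioning leaves the law of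
  -- the walk unchanged and the factors `1 - p` and `p` cancel.
  have hPS : P (singleThenPair o t) = ENNReal.ofReal ((1 - p) * p) := by
    rw [hS, h.measure_consecutive hp hp1]
    simp [Finset.sum_filter, Fintype.sum_sum_type, Fintype.sum_prod_type, emissionProb_inl,
      emissionProb_inr, ← Finset.mul_sum, sum_softmax]
  have hAf' : ∀ c : Vec d, ∑ z ∈ Finset.univ.filter (fun z : Emission V => z.isLeft ∧ A z),
      emissionProb v T p c z = (1 - p) * f c := fun c => by
    rw [← hAf, Finset.sum_filter, Fintype.sum_sum_type]
    simp [emissionProb_inl, Finset.mul_sum]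
  have hAg' : ∀ c : Vec d, ∑ z ∈ Finset.univ.filter (fun z : Emission V => z.isRight ∧ A' z),
      emissionProb v T p c z = p * g c := fun c => by
    rw [← hAg, Finset.sum_filter, Fintype.sum_sum_type, Fintype.sum_prod_type]
    simp [emissionProb_inr, Finset.mul_sum, mul_assoc]
  have hg0 : ∀ c, 0 ≤ g c := fun c => by
    rw [← hAg]
    refine Finset.sum_nonneg fun a _ => Finset.sum_nonneg fun b _ => ?_
    split_ifs
    · exact (mul_pos (softmax_pos _ _ _) (softmax_pos _ _ _)).le
    · exact le_rfl
  have hpp : 0 < (1 - p) * p := mul_pos (by linarith) hp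
  have hmc := fun t => measurable_subtype_coe.comp (h.walk.measurable t)
  rw [measureReal_def, cond_apply hSm, hPS, hSE, h.measure_consecutive hp hp1]
  simp only [hAf', hAg']
  rw [integral_eq_lintegral_of_nonneg_ae (f := fun ω => f (c t ω) * g (c (t + 1) ω))
    (ae_of_all _ fun ω => mul_nonneg (hf0 _) (hg0 _))
    ((hf.measurable.comp (hmc t)).mul (hg.measurable.comp (hmc (t + 1)))).aestronglyMeasurable]
  congr 1
  rw [← lintegral_const_mul']
  · refine lintegral_congr fun ω => ?_
    rw [← ENNReal.ofReal_inv_of_pos hpp, ← ENNReal.ofReal_mul (by positivity)]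
    congr 1
    have : 1 - p ≠ 0 := by linarith
    field_simp
  · simpa using hpp

end Model

lemma LogApprox.mono {p x η η' : ℝ} (h : LogApprox p x η) (hη : η ≤ η') : LogApprox p x η' :=
  ⟨h.1, h.2.trans hη⟩

lemma one_le_polylog (m : ℕ) {x : ℕ} (hx : 1 ≤ x) : 1 ≤ polylog m x :=
  one_le_pow₀ (by
    have := Real.log_nonneg (show (1 : ℝ) ≤ x by exact_mod_cast hx)
    linarith)

lemma norm_pairVec_le {V : Type*} [Fintype V] {d : ℕ} {v : V → Vec d} {T : Tensor d} {K R ε : ℝ}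
    (hT : IsBounded v T K ε) (hv : ∀ i, ‖v i‖ ≤ R * √d) (a b : V) :
    ‖pairVec v T a b‖ ≤ (R + √K) * √d := by
  have h : ‖T.app2 (v a) (v b)‖ ≤ √K * √d := by
    rw [← Real.sqrt_mul' K (by positivity)]
    exact Real.le_sqrt_of_sq_le (hT.vector a b)
  calc _ ≤ ‖v b‖ + ‖T.app2 (v a) (v b)‖ := norm_add_le _ _
    _ ≤ R * √d + √K * √d := add_le_add (hv b) h
    _ = _ := by ring

/-- An almost sure event is nonempty, and a norm is nonnegative. The sign is needed to absorb the
errors into `εp`. -/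
lemma IsDiscourseWalk.step_nonneg {Ω : Type*} [MeasurableSpace Ω] {P : Measure Ω}
    [IsProbabilityMeasure P] {d : ℕ} {c : ℕ → Ω → Sph d} {εw : ℝ} (h : IsDiscourseWalk P c εw)
    (hd : 1 ≤ d) : 0 ≤ εw := by
  obtain ⟨ω, hω⟩ := (h.step_le 0).exists
  have h0 : (0 : ℝ) < √d := Real.sqrt_pos.2 (by exact_mod_cast hd)
  have := (norm_nonneg _).trans hω
  by_contra! hlt
  linarith [div_neg_of_neg_of_pos hlt h0]

lemma wordsProb_eq_prod_softmax {V : Type*} [Fintype V] {d m : ℕ} (y : Fin m → V → Vec d)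
    (w : Fin m → V) (c : Vec d) : wordsProb y w c = ∏ l, softmax (y l) (w l) c := rfl

/-! ### The four probabilities as expectations -/

section Probabilities

variable {V : Type*} [Fintype V] {d : ℕ} {v : V → Vec d} {T : Tensor d} {Ω : Type*}
  [MeasurableSpace Ω] {P : Measure Ω} [IsProbabilityMeasure P] {c : ℕ → Ω → Sph d}
  {o : ℕ → Ω → Emission V} {p εw : ℝ}

open Classical in
lemma sum_ite_root_eq {V : Type*} [Fintype V] (F : V → ℝ) (w : V) :
    (∑ w', if Emission.root (Sum.inl w' : Emission V) = w then F w' else 0) = F w := by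
  simp only [Emission.root, Sum.elim_inl, id]
  rw [Finset.sum_eq_single w (fun w' _ hne => by simp [hne]) (by simp)]
  simp

lemma IsModel.probRoot_eq (h : IsModel v T p εw P c o) (hp : 0 < p) (hp1 : p < 1) (t : ℕ) (a : V) :
    probRoot P o t a = ∫ ω, 1 * softmax v a (c (t + 1) ω : Vec d) ∂P := by
  classical
  have := nonempty_of_emissions P o
  refine h.cond_real hp hp1 t (fun _ => True) (fun z => z.root = a) (f := fun _ => 1)
    (g := softmax v a) (by simp) (fun _ => zero_le_one) continuous_const (continuous_softmax _ _)
    (fun c => by simp [sum_softmax]) fun c => ?_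
  simp only [Emission.root, Sum.elim_inr]
  rw [Finset.sum_eq_single a (fun a' _ hne => by simp [hne]) (by simp)]
  simp [← Finset.mul_sum, sum_softmax]

lemma IsModel.probWordRoot_eq (h : IsModel v T p εw P c o) (hp : 0 < p) (hp1 : p < 1) (t : ℕ)
    (w a : V) :
    probWordRoot P o t w a
      = ∫ ω, softmax v w (c t ω : Vec d) * softmax v a (c (t + 1) ω : Vec d) ∂P := by
  classical
  have := nonempty_of_emissions P o
  refine h.cond_real hp hp1 t (fun z => z.root = w) (fun z => z.root = a) (f := softmax v w)
    (g := softmax v a) (by simp) (fun _ => (softmax_pos _ _ _).le) (continuous_softmax _ _)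
    (continuous_softmax _ _) (fun c => sum_ite_root_eq _ w) fun c => ?_
  simp only [Emission.root, Sum.elim_inr]
  rw [Finset.sum_eq_single a (fun a' _ hne => by simp [hne]) (by simp)]
  simp [← Finset.mul_sum, sum_softmax]

lemma sum_ite_eq_pair [DecidableEq V] (F : V → V → ℝ) (a b : V) :
    (∑ a', ∑ b', if (Sum.inr (a', b') : Emission V) = Sum.inr (a, b) then F a' b' else 0)
      = F a b := by
  rw [Finset.sum_eq_single a (fun a' _ hne => by simp [hne]) (by simp)]
  simp

lemma IsModel.probPair_eq (h : IsModel v T p εw P c o) (hp : 0 < p) (hp1 : p < 1) (t : ℕ)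
    (a b : V) :
    probPair P o t a b = ∫ ω, 1 * (softmax v a (c (t + 1) ω : Vec d)
      * softmax (pairVec v T a) b (c (t + 1) ω : Vec d)) ∂P := by
  classical
  have := nonempty_of_emissions P o
  refine h.cond_real hp hp1 t (fun _ => True) (fun z => z = Sum.inr (a, b)) (f := fun _ => 1)
    (g := fun c => softmax v a c * softmax (pairVec v T a) b c) (by simp) (fun _ => zero_le_one)
    continuous_const ((continuous_softmax _ _).mul (continuous_softmax _ _))
    (fun c => by simp [sum_softmax]) fun c => ?_
  convert! sum_ite_eq_pair (fun a b => softmax v a c * softmax (pairVec v T a) b c) a b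

lemma IsModel.probWordPair_eq (h : IsModel v T p εw P c o) (hp : 0 < p) (hp1 : p < 1) (t : ℕ)
    (w a b : V) :
    probWordPair P o t w a b = ∫ ω, softmax v w (c t ω : Vec d) *
      (softmax v a (c (t + 1) ω : Vec d)
        * softmax (pairVec v T a) b (c (t + 1) ω : Vec d)) ∂P := by
  classical
  refine h.cond_real hp hp1 t (fun z => z.root = w) (fun z => z = Sum.inr (a, b))
    (f := softmax v w) (g := fun c => softmax v a c * softmax (pairVec v T a) b c) (by simp)
    (fun _ => (softmax_pos _ _ _).le)
    (continuous_softmax _ _) ((continuous_softmax _ _).mul (continuous_softmax _ _))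
    (fun c => sum_ite_root_eq _ w) fun c => ?_
  convert! sum_ite_eq_pair (fun a b => softmax v a c * softmax (pairVec v T a) b c) a b

end Probabilities

end SynRandWalk

end

/-! ### The main theorem -/

theorem theorem1
    -- the constants on which the constants of the conclusion may depend
    (K R θ C₁ c₁ : ℝ) (k : ℕ)
    (hK : 0 < K) (hR : 0 < R) (hθ : θ < 1) (hC₁ : 0 < C₁) (hc₁ : 0 < c₁) :
    ∃ (C : ℝ) (m : ℕ), 0 < C ∧
      ∀ (d : ℕ) (_ : 1 ≤ d)
        (V : Type*) [Fintype V] (n : ℕ) (_ : Fintype.card V = n) (_ : 2 ≤ n)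
        (v : V → SynRandWalk.Vec d) (T : SynRandWalk.Tensor d)
        (pSyn ε εw : ℝ) (_ : 0 < pSyn) (_ : pSyn < 1) (_ : 0 ≤ ε)
        (Ω : Type*) [MeasurableSpace Ω] (P : Measure Ω) [IsProbabilityMeasure P]
        (c : ℕ → Ω → SynRandWalk.Sph d) (o : ℕ → Ω → SynRandWalk.Emission V)
        (_ : SynRandWalk.IsModel v T pSyn εw P c o)
        (_ : SynRandWalk.IsBounded v T K ε)
        (_ : ∀ i, ‖v i‖ ≤ R * √(d : ℝ))
        (w a b : V) (Z Za εz εza : ℝ)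
        -- the partition function `Z_c` concentrates around `Z`
        (_ : 0 ≤ εz) (_ : εz ≤ θ)
        (_ : εz ≤ C₁ * (SynRandWalk.polylog k n / √(n : ℝ)))
        (_ : SynRandWalk.Concentrates (SynRandWalk.partition v) Z εz
          (Real.exp (-(c₁ * Real.log n ^ 2))))
        -- the partition function `Z_{c,a}` concentrates around `Z_a`
        (_ : 0 ≤ εza) (_ : εza ≤ θ)
        (_ : εza ≤ C₁ * ε + C₁ * (SynRandWalk.polylog k n / √(n : ℝ)))
        (_ : SynRandWalk.Concentrates (SynRandWalk.partitionAt v T a) Za εza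
          (Real.exp (-(c₁ * Real.log n ^ 2))))
        (t : ℕ) (εp : ℝ)
        (_ : εp = C * (ε + εw) +
          C * (SynRandWalk.polylog m n / √(n : ℝ) + SynRandWalk.polylog m d / d)),
        SynRandWalk.LogApprox (SynRandWalk.probRoot P o t a)
          (‖v a‖ ^ 2 / (2 * d) - Real.log Z) εp ∧
        SynRandWalk.LogApprox (SynRandWalk.probWordRoot P o t w a)
          (‖v w + v a‖ ^ 2 / (2 * d) - 2 * Real.log Z) εp ∧
        SynRandWalk.LogApprox (SynRandWalk.probPair P o t a b)
          (‖v a + v b + T.app2 (v a) (v b)‖ ^ 2 / (2 * d) - Real.log Z - Real.log Za) εp ∧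
        SynRandWalk.LogApprox (SynRandWalk.probWordPair P o t w a b)
          (‖v w + v a + v b + T.app2 (v a) (v b)‖ ^ 2 / (2 * d)
            - 2 * Real.log Z - Real.log Za) εp := by
  -- One, two or three words are picked; `R + √K` bounds both the embeddings and the vectors
  -- `pairVec`, in units of `√d`.
  obtain ⟨A₁, hA₁, H₁⟩ := SynRandWalk.log_integral_wordsProb 1 (S := R + √K) hθ hc₁
  obtain ⟨A₂, hA₂, H₂⟩ := SynRandWalk.log_integral_wordsProb 2 (S := R + √K) hθ hc₁
  obtain ⟨A₃, hA₃, H₃⟩ := SynRandWalk.log_integral_wordsProb 3 (S := R + √K) hθ hc₁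
  -- `2 R` pays for moving the first word's weight along one step of the walk, `3 C₁` for at most
  -- three partition functions, and `1` for the `1 / √n` and `1 / d` errors. The exponent `k` of the
  -- hypotheses suffices.
  refine ⟨2 * R + (A₁ + A₂ + A₃) * (3 * C₁ + 1), k, by positivity, ?_⟩
  intro d hd V _ n hn hn2 v T p ε εw hp hp1 hε Ω _ P _ c o hM hT hv w a b Z Za εz εza hz0 hzθ hz
    hZ hza0 hzaθ hza hZa t εp hεp
  have hεw := hM.walk.step_nonneg hd
  set N := SynRandWalk.polylog k n / √(n : ℝ)
  set D := SynRandWalk.polylog k d / (d : ℝ)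
  have hN : 1 / √(n : ℝ) ≤ N := by
    have := SynRandWalk.one_le_polylog k (x := n) (by omega)
    exact div_le_div_of_nonneg_right this (Real.sqrt_nonneg _)
  have hD : 1 / (d : ℝ) ≤ D := by
    have := SynRandWalk.one_le_polylog k hd
    exact div_le_div_of_nonneg_right this (Nat.cast_nonneg _)
  have hN0 : 0 ≤ N := le_trans (by positivity) hN
  have hD0 : 0 ≤ D := le_trans (by positivity) hD
  -- Each partition function contributes at most `C₁ N`, and only `Z_a`, which occurs at most once,
  -- adds `C₁ ε`.
  have herr : ∀ A ≤ A₁ + A₂ + A₃, 0 ≤ A → ∀ e ≤ 3 * (C₁ * N) + C₁ * ε, ∀ β ≤ 2 * R * εw,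
      β + A * (e + 1 / √(n : ℝ) + 1 / d) ≤ εp := by
    intro A hA hA0 e he β hβ
    have h1 : e + 1 / √(n : ℝ) + 1 / d ≤ (3 * C₁ + 1) * (ε + N + D) := by
      have h2 : 0 ≤ C₁ * ε := by positivity
      have h3 : 0 ≤ C₁ * D := by positivity
      linarith
    have h4 : A * (e + 1 / √(n : ℝ) + 1 / d)
        ≤ (A₁ + A₂ + A₃) * ((3 * C₁ + 1) * (ε + N + D)) :=
      (mul_le_mul_of_nonneg_left h1 hA0).trans (mul_le_mul_of_nonneg_right hA (by positivity))
    have h5 : 0 ≤ (A₁ + A₂ + A₃) * (3 * C₁ + 1) * εw := by positivity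
    have h6 : 0 ≤ 2 * R * (ε + N + D) := by positivity
    rw [hεp]
    linarith
  have hKR : ∀ i, ‖v i‖ ≤ (R + √K) * √(d : ℝ) := fun i => (hv i).trans (by
    gcongr; linarith [Real.sqrt_nonneg K])
  have hpair := SynRandWalk.norm_pairVec_le hT hv a
  have hZ' : SynRandWalk.Concentrates (SynRandWalk.expSum v) Z εz
      (Real.exp (-(c₁ * Real.log n ^ 2))) := hZ
  have hZa' : SynRandWalk.Concentrates (SynRandWalk.expSum (SynRandWalk.pairVec v T a)) Za εza
      (Real.exp (-(c₁ * Real.log n ^ 2))) := by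
    rwa [← SynRandWalk.partitionAt_eq_expSum]
  have hC1N : 0 ≤ C₁ * N := by positivity
  have hC1ε : 0 ≤ C₁ * ε := by positivity
  have hcont := SynRandWalk.continuous_softmax v
  have hcont' := SynRandWalk.continuous_softmax (SynRandWalk.pairVec v T a)
  have hpos := fun w c => (SynRandWalk.softmax_pos v w c).le
  have hpos' := fun w c => (SynRandWalk.softmax_pos (SynRandWalk.pairVec v T a) w c).le
  have hstep : ∀ x y : SynRandWalk.Vec d, ‖x - y‖ ≤ εw / √(d : ℝ) →
      SynRandWalk.softmax v w x ≤ Real.exp (2 * R * εw) * SynRandWalk.softmax v w y := fun x y h =>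
    SynRandWalk.softmax_le_exp_mul w h hd hR.le hv
  refine ⟨?_, ?_, ?_, ?_⟩
  · obtain ⟨h1, h2⟩ := H₁ d hd V n hn hn2 ![v] ![a] (by simpa using hKR) ![Z] ![εz]
      (by simpa using hz0) (by simpa using hzθ) (by simpa using hZ')
    simp only [SynRandWalk.wordsProb_eq_prod_softmax, Fin.prod_univ_one, Fin.sum_univ_one,
      Matrix.cons_val_fin_one] at h1 h2
    rw [hM.probRoot_eq hp hp1]
    -- No word is emitted from `c t` here: the transported factor is the constant `1`, hence `β =
    -- 0`.
    refine (hM.walk.logApprox t continuous_const (hcont a) (hpos a) (β := 0) (by simp)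
      (by simpa only [one_mul] using h1) (by simpa only [one_mul] using h2)).mono ?_
    exact herr A₁ (by linarith) hA₁.le _ (by linarith) _ (by positivity)
  · obtain ⟨h1, h2⟩ := H₂ d hd V n hn hn2 ![v, v] ![w, a] (by simpa [Fin.forall_fin_two] using hKR)
      ![Z, Z] ![εz, εz] (by simpa [Fin.forall_fin_two] using hz0)
      (by simpa [Fin.forall_fin_two] using hzθ) (by simpa [Fin.forall_fin_two] using hZ')
    simp only [SynRandWalk.wordsProb_eq_prod_softmax, Fin.prod_univ_two, Fin.sum_univ_two, Matrix.cons_val_zero,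
      Matrix.cons_val_one] at h1 h2
    rw [hM.probWordRoot_eq hp hp1, two_mul (Real.log Z)]
    refine (hM.walk.logApprox t (hcont w) (hcont a) (hpos a) hstep h1 h2).mono ?_
    exact herr A₂ (by linarith) hA₂.le _ (by linarith) _ le_rfl
  · obtain ⟨h1, h2⟩ := H₂ d hd V n hn hn2 ![v, SynRandWalk.pairVec v T a] ![a, b]
      (by simpa [Fin.forall_fin_two] using ⟨hKR, hpair⟩)
      ![Z, Za] ![εz, εza] (by simpa [Fin.forall_fin_two] using ⟨hz0, hza0⟩)
      (by simpa [Fin.forall_fin_two] using ⟨hzθ, hzaθ⟩)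
      (by simpa [Fin.forall_fin_two] using ⟨hZ', hZa'⟩)
    simp only [SynRandWalk.wordsProb_eq_prod_softmax, Fin.prod_univ_two, Fin.sum_univ_two, Matrix.cons_val_zero,
      Matrix.cons_val_one] at h1 h2
    rw [hM.probPair_eq hp hp1, sub_sub, add_assoc (v a)]
    refine (hM.walk.logApprox t continuous_const (g := fun c => SynRandWalk.softmax v a c *
        SynRandWalk.softmax (SynRandWalk.pairVec v T a) b c) ((hcont a).mul (hcont' b))
      (fun c => mul_nonneg (hpos a c) (hpos' b c)) (β := 0) (by simp)
      (by simpa only [one_mul] using h1) (by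
        simp only [one_mul]; exact h2)).mono ?_
    exact herr A₂ (by linarith) hA₂.le _ (by linarith) _ (by positivity)
  · obtain ⟨h1, h2⟩ := H₃ d hd V n hn hn2 ![v, v, SynRandWalk.pairVec v T a] ![w, a, b]
      (by simpa [Fin.forall_fin_succ] using ⟨hKR, hpair⟩)
      ![Z, Z, Za] ![εz, εz, εza] (by simpa [Fin.forall_fin_succ] using ⟨hz0, hza0⟩)
      (by simpa [Fin.forall_fin_succ] using ⟨hzθ, hzaθ⟩)
      (by simpa [Fin.forall_fin_succ] using ⟨hZ', hZa'⟩)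
    simp only [SynRandWalk.wordsProb_eq_prod_softmax, Fin.prod_univ_three, Fin.sum_univ_three,
      Matrix.cons_val, mul_assoc (SynRandWalk.softmax _ _ _)] at h1 h2
    rw [hM.probWordPair_eq hp hp1, sub_sub, two_mul (Real.log Z), add_assoc (v w + v a)]
    refine (hM.walk.logApprox t (hcont w) (g := fun c => SynRandWalk.softmax v a c *
        SynRandWalk.softmax (SynRandWalk.pairVec v T a) b c) ((hcont a).mul (hcont' b))
      (fun c => mul_nonneg (hpos a c) (hpos' b c)) hstep h1 h2).mono ?_
    exact herr A₃ (by linarith) hA₃.le _ (by linarith) _ le_rfl
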